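/- Let $n\ge 1$ be a number of sites, $d_1,\dots,d_n$ physical dimensions, $\phi_i:X\to\mathbb R^{d_i}$ feature maps, and $\mathbf x^{(1)},\dots,\mathbf x^{(m)}\in X^n$ data points; all of these are fixed. For bond dimensions $\alpha=(\alpha_1,\dots,\alpha_n)$, with sites counted modulo $n$, a periodic matrix product state (MPS) has real tensor entries $A^{s}_{i;ab}$ ($1\le s\le d_i$, $1\le a\le\alpha_i$, $1\le b\le\alpha_{i+1}$) and output $$\Psi(\mathbf x;A)=\sum_{s_1,\dots,s_n}\ \sum_{a_1,\dots,a_n}\ \prod_{i=1}^n A^{s_i}_{i;a_ia_{i+1}}\ \prod_{i=1}^n\phi_i^{s_i}(x_i).$$ At time $0$ the entries are independent with $A^{s}_{i;ab}(0)\sim\mathcal N\big(0,\sigma_i^2/\sqrt{\alpha_i\alpha_{i+1}}\big)$, where $\sigma_1,\dots,\sigma_n\ge 0$ are fixed. Let $L:\mathbb R^m\to\mathbb R$ be a fixed cost function of the outputs and let $T\ge 0$. Assume that, almost surely, $A$ follows the gradient flow on $[0,T]$ with learning rates $\eta_i=(\alpha_i\alpha_{i+1})^{-1/2}$: $$\frac{d}{dt}A^{s}_{i;ab}(t)=-\eta_i\sum_{j=1}^m\frac{\partial\Psi(\mathbf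 x^{(j)};A(t))}{\partial A^{s}_{i;ab}}\;d_j(t),\qquad d_j(t)=\partial_jL\big(\Psi(\mathbf x^{(1)};A(t)),\dots,\Psi(\mathbf x^{(m)};A(t))\big),$$ $L$ being differentiable at the outputs along the trajectory. Let all the bond dimensions tend to infinity, jointly along an arbitrary filter (so that in particular sequential limits are covered), and assume that for each $j$ the integrated training direction $\int_0^T|d_j(t)|\,dt$ is bounded in probability along this limit, that is, for every $\delta>0$ there is $C<\infty$ such that eventually $\mathbb P\big(\int_0^T|d_j(t)|\,dt>C\big)\le\delta$. Then the change of the tensor entries during training converges to zero in probability, uniformly over the entries: for every $\varepsilon>0$, $$\mathbb P\Big(\sup_{i,s,a,b}\ \sup_{t\in[0,T]}\big|A^{s}_{i;ab}(t)-A^{s}_{i;ab}(0)\big|\ge\varepsilon\Big)\longrightarrow 0 .$$ In particular this holds for every single entry (lazy training). -/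

import Mathlib

open MeasureTheory ProbabilityTheory Filter Topology
open scoped NNReal ENNReal

noncomputable section

/-- Positions of the entries `A i s a b` of a periodic matrix product state (MPS) with `n` sites,
physical dimensions `d` and bond dimensions `α`: a site `i` (counted modulo `n`), a physical index
`s`, a left bond index `a` and a right bond index `b`. -/
abbrev MPSIndex {n : ℕ} [NeZero n] (d α : Fin n → ℕ) : Type :=
  Σ i : Fin n, Fin (d i) × Fin (α i) × Fin (α (i + 1))

/-- The output `Ψ(x; A)` of the periodic MPS with tensors `A` on the input `x = (x₁, …, xₙ)`:
the full contraction of the tensors with the product feature map `⨂ᵢ φ i (x i)`. -/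
def mpsOutput {n : ℕ} [NeZero n] {X : Type*} {d α : Fin n → ℕ}
    (φ : ∀ i, X → Fin (d i) → ℝ) (x : Fin n → X) (A : MPSIndex d α → ℝ) : ℝ :=
  ∑ s : (∀ i, Fin (d i)), ∑ a : (∀ i, Fin (α i)),
    (∏ i, A ⟨i, s i, a i, a (i + 1)⟩) * ∏ i, φ i (x i) (s i)

/-- The vector of outputs on the data points `x 0, …, x (m - 1)`. -/
def mpsOutputs {n m : ℕ} [NeZero n] {X : Type*} {d α : Fin n → ℕ}
    (φ : ∀ i, X → Fin (d i) → ℝ) (x : Fin m → Fin n → X) (A : MPSIndex d α → ℝ) : Fin m → ℝ :=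
  fun j => mpsOutput φ (x j) A

/-- The training direction at the `j`-th data point: the `j`-th partial derivative of the cost
`L`, as a function of the outputs, at the current outputs. -/
def trainingDirection {n m : ℕ} [NeZero n] {X : Type*} {d α : Fin n → ℕ}
    (φ : ∀ i, X → Fin (d i) → ℝ) (x : Fin m → Fin n → X) (L : (Fin m → ℝ) → ℝ)
    (A : MPSIndex d α → ℝ) (j : Fin m) : ℝ :=
  fderiv ℝ L (mpsOutputs φ x A) (Pi.single j 1)

/-- The learning rate `(|αᵢ| |αᵢ₊₁|)^(-1/2)` of the entries at site `i`. -/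
def mpsLearningRate {n : ℕ} [NeZero n] (α : Fin n → ℕ) (i : Fin n) : ℝ :=
  (√((α i : ℝ) * (α (i + 1) : ℝ)))⁻¹

/-- The entries `A e` are independent centred Gaussians, of variance `σᵢ² / √(|αᵢ| |αᵢ₊₁|)` at
site `i`. -/
structure IsMPSGaussianInit {n : ℕ} [NeZero n] {Ω : Type*} [MeasurableSpace Ω] (P : Measure Ω)
    {d α : Fin n → ℕ} (σ : Fin n → ℝ≥0) (A : Ω → MPSIndex d α → ℝ) : Prop where
  hasLaw : ∀ e : MPSIndex d α, HasLaw (fun ω => A ω e)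
    (gaussianReal 0 (σ e.1 ^ 2 / NNReal.sqrt ((α e.1 : ℝ≥0) * (α (e.1 + 1) : ℝ≥0)))) P
  indep : iIndepFun (fun (e : MPSIndex d α) (ω : Ω) => A ω e) P

/-- The trajectory `A` follows on `[0, T]` the gradient flow of the cost `L` of the outputs, with
the site-dependent learning rates:
`dA_e/dt = - η_e ∑ j, ∂Ψ(x j)/∂A_e · ∂L/∂Ψ(x j)` for every entry `e`.
The cost need only be differentiable at the outputs that the trajectory visits. -/
structure IsMPSGradientFlow {n m : ℕ} [NeZero n] {X : Type*} {d α : Fin n → ℕ}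
    (φ : ∀ i, X → Fin (d i) → ℝ) (x : Fin m → Fin n → X) (L : (Fin m → ℝ) → ℝ)
    (T : ℝ) (A : ℝ → MPSIndex d α → ℝ) : Prop where
  differentiableAt : ∀ t ∈ Set.Icc 0 T, DifferentiableAt ℝ L (mpsOutputs φ x (A t))
  hasDeriv : ∀ t ∈ Set.Icc 0 T, ∀ e : MPSIndex d α,
    HasDerivWithinAt (fun r => A r e)
      (-(mpsLearningRate α e.1 *
        ∑ j, fderiv ℝ (mpsOutput φ (x j)) (A t) (Pi.single e 1) *
          trainingDirection φ x L (A t) j))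
      (Set.Icc 0 T) t

/-- A family of `[0, ∞]`-valued quantities is bounded in probability along the filter `l`. -/
def BoundedInProbability {ι Ω : Type*} [MeasurableSpace Ω] (P : Measure Ω) (l : Filter ι)
    (Y : ι → Ω → ℝ≥0∞) : Prop :=
  ∀ δ : ℝ≥0∞, 0 < δ → ∃ C : ℝ≥0, ∀ᶠ ν in l, P {ω | (C : ℝ≥0∞) < Y ν ω} ≤ δ

end

/-! ### Fourth moments of independent Gaussians -/

/-! Contracting the tensors with the features of one data point turns site `k` into a matrix from
the bonds of `k` to those of `k + 1`. The output is the trace of the cyclic product, and its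
derivative in an entry at `k` is a feature times an entry of the product of the other `n - 1` site
matrices. Everything is therefore governed by the operator norms of products along arcs of fewer
than `n` sites. An arc from the bonds of `k` to those of `l` is measured in units of `w_k w_l`, with
`w = α ^ (1/4)` (`bondWeight`).

At time 0 this unit controls the Frobenius norm, while the operator norm is of smaller order: with a
constant `V` depending only on `σ` and the features, the fourth power of the Schatten 4-norm of an
arc of length `r` has expectation at most `(3V)^r α_k α_l / min α`. This is proved by peeling off
one independent Gaussian matrix at a time and applying Wick's formula (`lintegral_arcProd_le`). By
Markov's inequality all arcs are at most `δ` units with probability tending to one, for each fixed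
`δ > 0` (`tendsto_measure_not_arcsBounded`).

The rest is deterministic. If all arcs are at most `M` units, the learning rates `(w_k
w_{k+1})^(-2)` bound the speed of every arc by `n K M^3 ∑ |d_j|` units (`norm_deriv_arcProd_le`),
where `K` depends only on the features. This is cubic in `M`, so for small `δ` a continuity argument
keeps the arcs below `2δ` units as long as each `∫ |d_j| ≤ C` (`IsMPSGradientFlow.arcsBounded`). The
speed of a single entry is linear in `M`, uniformly over positions, so each entry moves by at most
`2δ K m C` (`IsMPSGradientFlow.abs_sub_le`), which is as small as desired. -/

lemma integrable_pow_gaussianReal (v : ℝ≥0) (k : ℕ) :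
    Integrable (fun x : ℝ => x ^ k) (gaussianReal 0 v) := by
  have h := (memLp_id_gaussianReal (μ := 0) (v := v) (k : ℝ≥0)).integrable_norm_pow'
  refine Integrable.mono' h (by fun_prop) (ae_of_all _ fun x => ?_)
  simp

lemma hasDerivAt_integral_pow_mul_exp_gaussianReal (v : ℝ≥0) (k : ℕ) (t : ℝ) :
    HasDerivAt (fun t => ∫ x, x ^ k * Real.exp (t * x) ∂gaussianReal 0 v)
      (∫ x, x ^ (k + 1) * Real.exp (t * x) ∂gaussianReal 0 v) t := by
  refine hasDerivAt_integral_pow_mul_exp_real (X := id) ?_ k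
  simp [integrableExpSet_id_gaussianReal]

/-- If `E[x ^ k * exp (t * x)] = p t * exp (v * t ^ 2 / 2)` under a centred Gaussian of variance
`v`, then the corresponding polynomial for `k + 1` is `p' + v * t * p`. -/
lemma integral_pow_succ_mul_exp_gaussianReal (v : ℝ≥0) (k : ℕ) {p p' : ℝ → ℝ}
    (hp : ∀ t, HasDerivAt p (p' t) t)
    (h : ∀ t, ∫ x, x ^ k * Real.exp (t * x) ∂gaussianReal 0 v = p t * Real.exp (v * t ^ 2 / 2))
    (t : ℝ) :
    ∫ x, x ^ (k + 1) * Real.exp (t * x) ∂gaussianReal 0 v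
      = (p' t + v * t * p t) * Real.exp (v * t ^ 2 / 2) := by
  have h1 := hasDerivAt_integral_pow_mul_exp_gaussianReal v k t
  simp only [h] at h1
  have h2 : HasDerivAt (fun t : ℝ => (v : ℝ) * t ^ 2 / 2) (v * t) t := by
    have := (((hasDerivAt_id t).pow 2).const_mul (v : ℝ)).div_const 2
    refine this.congr_deriv ?_
    simp; ring
  refine h1.unique (((hp t).mul h2.exp).congr_deriv ?_)
  ring

/-- The moment generating function `exp (v t² / 2)` is differentiated four times and evaluated at `t
= 0`. -/
lemma integral_pow_gaussianReal (v : ℝ≥0) :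
    ∫ x, x ^ 1 ∂gaussianReal 0 v = 0 ∧ ∫ x, x ^ 2 ∂gaussianReal 0 v = v ∧
      ∫ x, x ^ 3 ∂gaussianReal 0 v = 0 ∧ ∫ x, x ^ 4 ∂gaussianReal 0 v = 3 * v ^ 2 := by
  have h0 : ∀ t : ℝ, ∫ x, x ^ 0 * Real.exp (t * x) ∂gaussianReal 0 v
      = 1 * Real.exp (v * t ^ 2 / 2) := by
    intro t
    have := congrFun (mgf_fun_id_gaussianReal (μ := 0) (v := v)) t
    simpa [mgf] using this
  have h1 := integral_pow_succ_mul_exp_gaussianReal v 0 (fun t => hasDerivAt_const t (1 : ℝ)) h0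
  -- Each `p` is kept in the unsimplified form `p' + v * t * p` produced by the previous step, so
  -- that the previous formula applies verbatim.
  have h2 := integral_pow_succ_mul_exp_gaussianReal v 1
    (p := fun t => 0 + v * t * 1) (p' := fun t => v)
    (fun t => by simpa using (hasDerivAt_id t).const_mul (v : ℝ)) h1
  have h3 := integral_pow_succ_mul_exp_gaussianReal v 2
    (p := fun t => v + v * t * (0 + v * t * 1)) (p' := fun t => 2 * v ^ 2 * t)
    (fun t => by
      have := ((((hasDerivAt_id t).pow 2).const_mul ((v : ℝ) ^ 2)).const_add (v : ℝ))
      convert! this using 1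
      · ext; simp; ring
      · simp; ring) h2
  have h4 := integral_pow_succ_mul_exp_gaussianReal v 3
    (p := fun t => 2 * v ^ 2 * t + v * t * (v + v * t * (0 + v * t * 1)))
    (p' := fun t => 3 * v ^ 2 + 3 * v ^ 3 * t ^ 2)
    (fun t => by
      have := ((hasDerivAt_id t).const_mul (3 * (v : ℝ) ^ 2)).add
        (((hasDerivAt_id t).pow 3).const_mul ((v : ℝ) ^ 3))
      convert! this using 1
      · ext; simp; ring
      · simp; ring) h3
  refine ⟨?_, ?_, ?_, ?_⟩
  · simp
  · simpa using h2 0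
  · simpa using h3 0
  · simpa using h4 0

section GaussianProduct

variable {E : Type*} [Fintype E]

/-- The law of independent centred Gaussians of variances `v e`. -/
noncomputable def gaussianProduct (v : E → ℝ≥0) : Measure (E → ℝ) :=
  Measure.pi fun e => gaussianReal 0 (v e)

instance (v : E → ℝ≥0) : IsProbabilityMeasure (gaussianProduct v) := by
  unfold gaussianProduct; infer_instance

lemma integral_monomial_gaussianProduct (v : E → ℝ≥0) (k : E → ℕ) :
    ∫ x, ∏ e, x e ^ k e ∂gaussianProduct v = ∏ e, ∫ y, y ^ k e ∂gaussianReal 0 (v e) :=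
  integral_fintype_prod_eq_prod (fun e (y : ℝ) => y ^ k e)

variable [DecidableEq E]

/-- The exponents of the monomial `x a * x b * x c * x d`. -/
def quarticExponent (a b c d e : E) : ℕ :=
  (if e = a then 1 else 0) + (if e = b then 1 else 0) + (if e = c then 1 else 0)
    + (if e = d then 1 else 0)

lemma prod_pow_quarticExponent (a b c d : E) (x : E → ℝ) :
    ∏ e, x e ^ quarticExponent a b c d e = x a * x b * x c * x d := by
  have h : ∀ a, ∏ e, x e ^ (if e = a then 1 else 0) = x a := fun a => by simp [pow_ite]
  simp only [quarticExponent, pow_add, Finset.prod_mul_distrib, h]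

lemma integrable_quartic_gaussianProduct (v : E → ℝ≥0) (a b c d : E) :
    Integrable (fun x => x a * x b * x c * x d) (gaussianProduct v) := by
  simp_rw [← prod_pow_quarticExponent a b c d]
  exact Integrable.fintype_prod (f := fun e (y : ℝ) => y ^ quarticExponent a b c d e)
    fun e => integrable_pow_gaussianReal (v e) _

/-- Wick's formula for four coordinates. -/
lemma integral_quartic_gaussianProduct (v : E → ℝ≥0) (a b c d : E) :
    ∫ x, x a * x b * x c * x d ∂gaussianProduct v =
      (if a = b then (v a : ℝ) else 0) * (if c = d then (v c : ℝ) else 0)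
      + (if a = c then (v a : ℝ) else 0) * (if b = d then (v b : ℝ) else 0)
      + (if a = d then (v a : ℝ) else 0) * (if b = c then (v b : ℝ) else 0) := by
  have hm := integral_monomial_gaussianProduct v (quarticExponent a b c d)
  simp_rw [prod_pow_quarticExponent a b c d] at hm
  rw [hm]
  -- The exponents sum to 4, so either some exponent is odd and its factor vanishes, or the pattern
  -- is 2 + 2 or 4. The value `3 v²` of the last pattern is the sum of all three pairings.
  have zero : ∀ e, quarticExponent a b c d e = 1 ∨ quarticExponent a b c d e = 3 →
      ∏ e, ∫ y, y ^ quarticExponent a b c d e ∂gaussianReal 0 (v e) = 0 := by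
    intro e he
    refine Finset.prod_eq_zero (Finset.mem_univ e) ?_
    rcases he with he | he <;> rw [he]
    exacts [(integral_pow_gaussianReal (v e)).1, (integral_pow_gaussianReal (v e)).2.2.1]
  have pair : ∀ e f, e ≠ f → quarticExponent a b c d e = 2 → quarticExponent a b c d f = 2 →
      (∀ g, g ≠ e ∧ g ≠ f → quarticExponent a b c d g = 0) →
      ∏ e, ∫ y, y ^ quarticExponent a b c d e ∂gaussianReal 0 (v e) = v e * v f := by
    intro e f hef he hf h
    rw [Finset.prod_eq_mul e f hef (fun g _ hg => by simp [h g hg]) (by simp) (by simp), he, hf,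
      (integral_pow_gaussianReal (v e)).2.1, (integral_pow_gaussianReal (v f)).2.1]
  have four : ∀ e, quarticExponent a b c d e = 4 → (∀ g, g ≠ e → quarticExponent a b c d g = 0) →
      ∏ e, ∫ y, y ^ quarticExponent a b c d e ∂gaussianReal 0 (v e) = 3 * (v e) ^ 2 := by
    intro e he h
    rw [Finset.prod_eq_single e (fun g _ hg => by simp [h g hg]) (by simp), he,
      (integral_pow_gaussianReal (v e)).2.2.2]
  by_cases hab : a = b
  · subst hab
    by_cases hcd : c = d
    · subst hcd
      by_cases hac : a = c
      · subst hac
        rw [four a (by simp [quarticExponent]) (by intro g hg; simp [quarticExponent, hg])]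
        simp; ring
      · rw [pair a c hac (by simp [quarticExponent, hac]) (by simp [quarticExponent, Ne.symm hac])
          (by rintro g ⟨h1, h2⟩; simp [quarticExponent, h1, h2])]
        simp [hac]
    · by_cases hac : a = c
      · subst hac
        rw [zero d (by simp [quarticExponent, Ne.symm hcd])]
        simp [hcd]
      · rw [zero c (by simp [quarticExponent, Ne.symm hac, hcd])]
        simp [hcd, hac]
  · by_cases hac : a = c
    · subst hac
      by_cases hbd : b = d
      · subst hbd
        rw [pair a b hab (by simp [quarticExponent, hab]) (by simp [quarticExponent, Ne.symm hab])
          (by rintro g ⟨h1, h2⟩; simp [quarticExponent, h1, h2])]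
        simp [hab]
      · rw [zero b (by simp [quarticExponent, Ne.symm hab, hbd])]
        simp [hab, hbd, Ne.symm hab]
    · by_cases had : a = d
      · subst had
        by_cases hbc : b = c
        · subst hbc
          rw [pair a b hab (by simp [quarticExponent, hab]) (by simp [quarticExponent, Ne.symm hab])
            (by rintro g ⟨h1, h2⟩; simp [quarticExponent, h1, h2])]
          simp [hab]
        · rw [zero b (by simp [quarticExponent, Ne.symm hab, hbc])]
          simp [hab, hbc, hac]
      · rw [zero a (by simp [quarticExponent, hab, hac, had])]
        simp [hab, hac, had]

/-- The covariance of the linear forms `s` and `t` under `gaussianProduct v`. -/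
def gaussianCov (v : E → ℝ≥0) (s t : E → ℝ) : ℝ := ∑ e, s e * t e * v e

omit [DecidableEq E] in
lemma integrable_linear_quartic_gaussianProduct (v : E → ℝ≥0) (s t u w : E → ℝ) :
    Integrable (fun x => (s ⬝ᵥ x) * (t ⬝ᵥ x) * (u ⬝ᵥ x) * (w ⬝ᵥ x)) (gaussianProduct v) := by
  classical
  simp only [dotProduct, Finset.sum_mul, Finset.mul_sum]
  refine integrable_finsetSum _ fun a _ => integrable_finsetSum _ fun b _ =>
    integrable_finsetSum _ fun c _ => integrable_finsetSum _ fun d _ => ?_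
  refine ((integrable_quartic_gaussianProduct v d c b a).const_mul (s d * t c * u b * w a)).congr
    (ae_of_all _ fun x => ?_)
  simp only; ring

omit [DecidableEq E] in
/-- Wick's formula for four linear forms. -/
lemma integral_linear_quartic_gaussianProduct (v : E → ℝ≥0) (s t u w : E → ℝ) :
    ∫ x, (s ⬝ᵥ x) * (t ⬝ᵥ x) * (u ⬝ᵥ x) * (w ⬝ᵥ x) ∂gaussianProduct v =
      gaussianCov v s t * gaussianCov v u w + gaussianCov v s u * gaussianCov v t w
      + gaussianCov v s w * gaussianCov v t u := by
  classical
  have key : ∀ x : E → ℝ, (s ⬝ᵥ x) * (t ⬝ᵥ x) * (u ⬝ᵥ x) * (w ⬝ᵥ x) =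
      ∑ a, ∑ b, ∑ c, ∑ d, (s a * t b * u c * w d) * (x a * x b * x c * x d) := by
    intro x
    have h : ∀ a b c d, (s a * t b * u c * w d) * (x a * x b * x c * x d) =
        (s a * x a) * ((t b * x b) * ((u c * x c) * (w d * x d))) := fun _ _ _ _ => by ring
    simp only [h, ← Finset.mul_sum, ← Finset.sum_mul, dotProduct]
    ring
  simp_rw [key]
  have hi : ∀ a b c d, Integrable
      (fun x : E → ℝ => (s a * t b * u c * w d) * (x a * x b * x c * x d)) (gaussianProduct v) :=
    fun a b c d => (integrable_quartic_gaussianProduct v a b c d).const_mul _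
  rw [integral_finsetSum _ fun a _ => integrable_finsetSum _ fun b _ =>
    integrable_finsetSum _ fun c _ => integrable_finsetSum _ fun d _ => hi a b c d]
  simp_rw [fun a => integral_finsetSum (μ := gaussianProduct v) Finset.univ fun b _ =>
    integrable_finsetSum Finset.univ fun c _ => integrable_finsetSum Finset.univ
      fun d _ => hi a b c d]
  simp_rw [fun a b => integral_finsetSum (μ := gaussianProduct v) Finset.univ fun c _ =>
    integrable_finsetSum Finset.univ fun d _ => hi a b c d]
  simp_rw [fun a b c => integral_finsetSum (μ := gaussianProduct v) Finset.univ fun d _ =>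
    hi a b c d]
  simp_rw [integral_const_mul, integral_quartic_gaussianProduct, mul_add, Finset.sum_add_distrib]
  unfold gaussianCov
  simp only [Finset.sum_mul_sum]
  congr 1
  · congr 1
    · refine Finset.sum_congr rfl fun a _ => ?_
      simp only [mul_ite, ite_mul, zero_mul, mul_zero, Finset.sum_ite_eq, Finset.mem_univ, if_true,
        Finset.sum_ite_irrel, Finset.sum_const_zero]
      exact Finset.sum_congr rfl fun b _ => by ring
    · refine Finset.sum_congr rfl fun a _ => ?_
      refine Finset.sum_congr rfl fun b _ => ?_
      simp only [mul_ite, ite_mul, zero_mul, mul_zero, Finset.sum_ite_eq, Finset.mem_univ, if_true]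
      ring
  · refine Finset.sum_congr rfl fun a _ => ?_
    refine Finset.sum_congr rfl fun b _ => ?_
    simp only [mul_ite, ite_mul, zero_mul, mul_zero, Finset.sum_ite_eq, Finset.mem_univ, if_true,
      Finset.sum_ite_irrel, Finset.sum_const_zero]
    ring

omit [DecidableEq E] in
/-- Resampling the coordinates in `s` independently does not change the law. -/
lemma measurePreserving_resample (v : E → ℝ≥0) (s : E → Prop) [DecidablePred s] :
    MeasurePreserving (fun p : (E → ℝ) × (E → ℝ) => fun e => if s e then p.1 e else p.2 e)
      ((gaussianProduct v).prod (gaussianProduct v)) (gaussianProduct v) := by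
  have hm : Measurable (fun p : (E → ℝ) × (E → ℝ) => fun e => if s e then p.1 e else p.2 e) := by
    refine measurable_pi_lambda _ fun e => ?_
    by_cases h : s e <;> simp only [h, if_true, if_false] <;> fun_prop
  refine ⟨hm, ?_⟩
  unfold gaussianProduct
  symm
  refine Measure.pi_eq fun B hB => ?_
  rw [Measure.map_apply hm (MeasurableSet.univ_pi hB)]
  have : (fun p : (E → ℝ) × (E → ℝ) => fun e => if s e then p.1 e else p.2 e) ⁻¹' Set.univ.pi B =
      (Set.univ.pi fun e => if s e then B e else Set.univ) ×ˢ
        (Set.univ.pi fun e => if s e then Set.univ else B e) := by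
    ext p
    simp only [Set.mem_preimage, Set.mem_univ_pi, Set.mem_prod, ← forall_and]
    refine forall_congr' fun e => ?_
    by_cases h : s e <;> simp [h]
  rw [this, Measure.prod_prod, Measure.pi_pi, Measure.pi_pi, ← Finset.prod_mul_distrib]
  refine Finset.prod_congr rfl fun e _ => ?_
  by_cases h : s e <;> simp [h]

end GaussianProduct

/-! ### Zero-padded site matrices and their products along arcs -/

section Arcs

open Matrix

variable {n : ℕ} [NeZero n]

/-- The site `r` steps after `k` on the cycle. -/
def siteShift : ℕ → Fin n → Fin n
  | 0, k => k
  | r + 1, k => siteShift r (k + 1)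

lemma siteShift_add (r s : ℕ) (k : Fin n) : siteShift (r + s) k = siteShift s (siteShift r k) := by
  induction r generalizing k with
  | zero => simp [siteShift]
  | succ r ih => rw [Nat.add_right_comm]; exact ih (k + 1)

lemma siteShift_succ (r : ℕ) (k : Fin n) : siteShift (r + 1) k = siteShift r k + 1 :=
  siteShift_add r 1 k

lemma val_siteShift (r : ℕ) (k : Fin n) : (siteShift r k).val = (k.val + r) % n := by
  induction r with
  | zero => simp [siteShift, Nat.mod_eq_of_lt k.isLt]
  | succ r ih =>
    rw [siteShift_succ, Fin.val_add, ih, Fin.val_one', ← Nat.add_mod, Nat.add_assoc]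

lemma siteShift_self (k : Fin n) : siteShift n k = k :=
  Fin.ext (by rw [val_siteShift, Nat.add_mod_right, Nat.mod_eq_of_lt k.isLt])

lemma siteShift_pred_succ (k : Fin n) : siteShift (n - 1) (k + 1) = k := by
  have h : siteShift (n - 1 + 1) k = k := by
    rw [Nat.sub_add_cancel NeZero.one_le]; exact siteShift_self k
  exact h

lemma siteShift_val_zero (k : Fin n) : siteShift k.val (0 : Fin n) = k :=
  Fin.ext (by rw [val_siteShift]; simp [Nat.mod_eq_of_lt k.isLt])

/-- This makes the output affine in each entry, and the first factor of an arc independent of the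
others. -/
lemma siteShift_ne_self {r : ℕ} (hr0 : 0 < r) (hr : r < n) (k : Fin n) : siteShift r k ≠ k := by
  intro h
  have := congrArg Fin.val h
  rw [val_siteShift] at this
  have hk := k.isLt
  rcases Nat.lt_or_ge (k.val + r) n with h1 | h1
  · rw [Nat.mod_eq_of_lt h1] at this; omega
  · rw [Nat.mod_eq_sub_mod h1, Nat.mod_eq_of_lt (by omega)] at this; omega

/-- The bond indices of all the sites together. -/
abbrev BondIndex (α : Fin n → ℕ) : Type := Σ i : Fin n, Fin (α i)

variable {α : Fin n → ℕ}

/-- The projection to the bond indices of the site `k`. -/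
def bondProj (α : Fin n → ℕ) (k : Fin n) : Matrix (BondIndex α) (BondIndex α) ℝ :=
  diagonal fun p => if p.1 = k then 1 else 0

/-- The matrices `N k` are supported on the block from the bonds of `k` to those of `k + 1`. -/
def IsBlockSupported (N : Fin n → Matrix (BondIndex α) (BondIndex α) ℝ) : Prop :=
  ∀ k, (∀ p q, p.1 ≠ k → N k p q = 0) ∧ ∀ p q, q.1 ≠ k + 1 → N k p q = 0

lemma IsBlockSupported.proj_mul {N : Fin n → Matrix (BondIndex α) (BondIndex α) ℝ}
    (hN : IsBlockSupported N) (k : Fin n) : bondProj α k * N k = N k := by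
  ext p q
  rw [bondProj, diagonal_mul]
  by_cases h : p.1 = k
  · simp [h]
  · simp [h, (hN k).1 p q h]

lemma IsBlockSupported.mul_proj {N : Fin n → Matrix (BondIndex α) (BondIndex α) ℝ}
    (hN : IsBlockSupported N) (k : Fin n) : N k * bondProj α (k + 1) = N k := by
  ext p q
  rw [bondProj, mul_diagonal]
  by_cases h : q.1 = k + 1
  · simp [h]
  · simp [h, (hN k).2 p q h]

omit [NeZero n] in
lemma bondProj_mul_self (k : Fin n) : bondProj α k * bondProj α k = bondProj α k := by
  simp [bondProj]

/-- The product `N k * N (k + 1) * ⋯` of `r` factors; the projection to the site `k` if `r = 0`. -/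
def arcProd (N : Fin n → Matrix (BondIndex α) (BondIndex α) ℝ) :
    ℕ → Fin n → Matrix (BondIndex α) (BondIndex α) ℝ
  | 0, k => bondProj α k
  | r + 1, k => N k * arcProd N r (k + 1)

lemma arcProd_cycle (N : Fin n → Matrix (BondIndex α) (BondIndex α) ℝ) (k : Fin n) :
    arcProd N n k = N k * arcProd N (n - 1) (k + 1) := by
  have h : arcProd N (n - 1 + 1) k = N k * arcProd N (n - 1) (k + 1) := rfl
  rwa [Nat.sub_add_cancel NeZero.one_le] at h

lemma arcProd_congr {N N' : Fin n → Matrix (BondIndex α) (BondIndex α) ℝ} {r : ℕ} {k : Fin n}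
    (h : ∀ i < r, N (siteShift i k) = N' (siteShift i k)) : arcProd N r k = arcProd N' r k := by
  induction r generalizing k with
  | zero => rfl
  | succ r ih =>
    have h0 : N k = N' k := h 0 (Nat.succ_pos r)
    simp only [arcProd, h0]
    rw [ih fun i hi => h (i + 1) (Nat.succ_lt_succ hi)]

namespace IsBlockSupported

variable {N : Fin n → Matrix (BondIndex α) (BondIndex α) ℝ} (hN : IsBlockSupported N)
include hN

lemma proj_mul_arcProd (r : ℕ) (k : Fin n) : bondProj α k * arcProd N r k = arcProd N r k := by
  cases r with
  | zero => exact bondProj_mul_self k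
  | succ r => rw [arcProd, ← mul_assoc, hN.proj_mul]

lemma arcProd_mul (r s : ℕ) (k : Fin n) :
    arcProd N r k * arcProd N s (siteShift r k) = arcProd N (r + s) k := by
  induction r generalizing k with
  | zero => rw [Nat.zero_add]; exact hN.proj_mul_arcProd s k
  | succ r ih =>
    rw [Nat.add_right_comm, arcProd, arcProd, mul_assoc, siteShift, ih]

lemma arcProd_mul_proj (r : ℕ) (k : Fin n) :
    arcProd N r k * bondProj α (siteShift r k) = arcProd N r k :=
  hN.arcProd_mul r 0 k

lemma arcProd_one (k : Fin n) : arcProd N 1 k = N k := hN.mul_proj k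

lemma arcProd_apply_eq_zero_left {r : ℕ} {k : Fin n} {p : BondIndex α} (q : BondIndex α)
    (h : p.1 ≠ k) : arcProd N r k p q = 0 := by
  rw [← hN.proj_mul_arcProd, bondProj, diagonal_mul, if_neg h, zero_mul]

lemma arcProd_apply_eq_zero_right {r : ℕ} {k : Fin n} (p : BondIndex α) {q : BondIndex α}
    (h : q.1 ≠ siteShift r k) : arcProd N r k p q = 0 := by
  rw [← hN.arcProd_mul_proj, bondProj, mul_diagonal, if_neg h, mul_zero]

lemma trace_arcProd_succ (k : Fin n) :
    (arcProd N n (k + 1)).trace = (arcProd N n k).trace := by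
  have h1 : arcProd N n k = arcProd N 1 k * arcProd N (n - 1) (k + 1) := by
    rw [hN.arcProd_one, arcProd_cycle]
  have h2 : arcProd N n (k + 1) = arcProd N (n - 1) (k + 1) * arcProd N 1 k := by
    have := hN.arcProd_mul (n - 1) 1 (k + 1)
    rwa [siteShift_pred_succ, Nat.sub_add_cancel NeZero.one_le, eq_comm] at this
  rw [h1, h2, trace_mul_comm]

lemma trace_arcProd_eq (k : Fin n) : (arcProd N n k).trace = (arcProd N n 0).trace := by
  have : ∀ r, (arcProd N n (siteShift r 0)).trace = (arcProd N n 0).trace := by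
    intro r
    induction r with
    | zero => rfl
    | succ r ih => rw [siteShift_succ, hN.trace_arcProd_succ, ih]
  rw [← this k.val, siteShift_val_zero]

omit hN in
-- Expansion over paths of bond indices. The support condition on `F` absorbs the projection that
-- ends the arc.
lemma sum_arcProd_mul (r : ℕ) (k : Fin n) (p : BondIndex α) (F : BondIndex α → ℝ)
    (hF : ∀ q, q.1 ≠ siteShift r k → F q = 0) :
    ∑ q, arcProd N r k p q * F q = ∑ c : Fin r → BondIndex α,
      (∏ i : Fin r, N (siteShift i k)
        ((Fin.cons p c : Fin (r + 1) → BondIndex α) i.castSucc)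
        ((Fin.cons p c : Fin (r + 1) → BondIndex α) i.succ)) *
      F ((Fin.cons p c : Fin (r + 1) → BondIndex α) (Fin.last r)) := by
  induction r generalizing k p with
  | zero =>
    simp only [arcProd, bondProj, diagonal_apply, Finset.univ_unique, Finset.sum_singleton,
      Finset.univ_eq_empty, Finset.prod_empty, one_mul, ite_mul, zero_mul, Finset.sum_ite_eq,
      Finset.mem_univ, if_true]
    change _ = F p
    by_cases h : p.1 = k
    · simp [h]
    · simp [h, hF p h]
  | succ r ih =>
    simp only [arcProd, mul_apply, Finset.sum_mul]
    rw [Finset.sum_comm]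
    simp only [mul_assoc, ← Finset.mul_sum]
    rw [← (Fin.consEquiv fun _ => BondIndex α).sum_comp, Fintype.sum_prod_type]
    refine Finset.sum_congr rfl fun x _ => ?_
    rw [ih (k + 1) x hF, Finset.mul_sum]
    refine Finset.sum_congr rfl fun c _ => ?_
    rw [Fin.prod_univ_succ, mul_assoc]
    rfl

lemma trace_arcProd (hn : 0 < n) :
    (arcProd N n 0).trace = ∑ c : Fin n → BondIndex α, ∏ i, N i (c i) (c (i + 1)) := by
  obtain ⟨r, rfl⟩ : ∃ r, n = r + 1 := ⟨n - 1, by omega⟩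
  rw [← hN.arcProd_mul r 1 0, hN.arcProd_one]
  simp only [trace, diag_apply, mul_apply]
  rw [← (Fin.consEquiv fun _ => BondIndex α).sum_comp, Fintype.sum_prod_type]
  refine Finset.sum_congr rfl fun p _ => ?_
  -- The open path of `r = n - 1` steps is closed up by the matrix of the last site, which plays the
  -- role of `F`.
  rw [sum_arcProd_mul r 0 p (fun q => N (siteShift r 0) q p) fun q hq => (hN _).1 q p hq]
  refine Finset.sum_congr rfl fun c _ => ?_
  rw [Fin.prod_univ_castSucc]
  have hl : siteShift r (0 : Fin (r + 1)) = Fin.last r := siteShift_val_zero (Fin.last r)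
  congr 1
  · refine Finset.prod_congr rfl fun i _ => ?_
    have hi : siteShift i (0 : Fin (r + 1)) = i.castSucc := siteShift_val_zero i.castSucc
    rw [hi, Fin.coeSucc_eq_succ]
    rfl
  · rw [hl, Fin.last_add_one]
    rfl

end IsBlockSupported

/-! ### Site matrices and the partial derivatives of the output. -/

variable {d : Fin n → ℕ}

/-- The tensor of the site `k`, contracted with the features `f k` and padded with zeros. -/
def siteMatrix (f : ∀ i, Fin (d i) → ℝ) (A : MPSIndex d α → ℝ) (k : Fin n) :
    Matrix (BondIndex α) (BondIndex α) ℝ :=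
  ∑ s, ∑ a, ∑ b, (f k s * A ⟨k, s, a, b⟩) • single ⟨k, a⟩ ⟨k + 1, b⟩ 1

lemma siteMatrix_apply (f : ∀ i, Fin (d i) → ℝ) (A : MPSIndex d α → ℝ) (k : Fin n)
    (a : Fin (α k)) (b : Fin (α (k + 1))) :
    siteMatrix f A k ⟨k, a⟩ ⟨k + 1, b⟩ = ∑ s, f k s * A ⟨k, s, a, b⟩ := by
  simp only [siteMatrix, Matrix.sum_apply, Matrix.smul_apply, single_apply, smul_eq_mul, mul_ite,
    mul_one, mul_zero, Sigma.mk.injEq, heq_eq_eq, true_and]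
  refine Finset.sum_congr rfl fun s _ => ?_
  simp [ite_and]

lemma isBlockSupported_siteMatrix (f : ∀ i, Fin (d i) → ℝ) (A : MPSIndex d α → ℝ) :
    IsBlockSupported (siteMatrix f A) := by
  refine fun k => ⟨fun p q h => ?_, fun p q h => ?_⟩ <;>
  · simp only [siteMatrix, Matrix.sum_apply, Matrix.smul_apply, single_apply, smul_eq_mul]
    refine Finset.sum_eq_zero fun s _ => Finset.sum_eq_zero fun a _ =>
      Finset.sum_eq_zero fun b _ => ?_
    rw [if_neg, mul_zero]
    rintro ⟨rfl, rfl⟩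
    exact h rfl

/-- In the expansion of the trace over closed paths, the zero padding kills every path that leaves
the blocks of its sites. The free base point `k` allows any chosen site to be the first factor. -/
lemma mpsOutput_eq_trace {X : Type*} (φ : ∀ i, X → Fin (d i) → ℝ) (x : Fin n → X)
    (A : MPSIndex d α → ℝ) (k : Fin n) :
    mpsOutput φ x A = (arcProd (siteMatrix (fun i => φ i (x i)) A) n k).trace := by
  have hN := isBlockSupported_siteMatrix (fun i => φ i (x i)) A
  rw [hN.trace_arcProd_eq, hN.trace_arcProd (NeZero.pos n), mpsOutput, Finset.sum_comm]
  rw [← Fintype.sum_of_injective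
    (fun (a : ∀ i, Fin (α i)) (i : Fin n) => (⟨i, a i⟩ : BondIndex α))
    (fun a a' h => funext fun i => by simpa using congrFun h i)
    (fun a => ∏ i, ∑ s, φ i (x i) s * A ⟨i, s, a i, a (i + 1)⟩)]
  · refine Finset.sum_congr rfl fun a _ => ?_
    rw [Finset.prod_univ_sum, Fintype.piFinset_univ]
    refine Finset.sum_congr rfl fun s _ => ?_
    rw [Finset.prod_mul_distrib, mul_comm]
  · intro c hc
    have : ∃ i, (c i).1 ≠ i := by
      by_contra! h
      refine hc ⟨fun i => h i ▸ (c i).2, funext fun i => ?_⟩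
      refine Sigma.ext (h i).symm ?_
      simp
    obtain ⟨i, hi⟩ := this
    exact Finset.prod_eq_zero (Finset.mem_univ i) ((hN i).1 _ _ hi)
  · intro a
    exact Finset.prod_congr rfl fun i _ => (siteMatrix_apply (fun i => φ i (x i)) A i (a i) (a (i + 1))).symm

lemma siteMatrix_add_single (f : ∀ i, Fin (d i) → ℝ) (A : MPSIndex d α → ℝ) (e : MPSIndex d α)
    (t : ℝ) :
    siteMatrix f (A + t • Pi.single e 1) e.1 =
      siteMatrix f A e.1 + (t * f e.1 e.2.1) • single ⟨e.1, e.2.2.1⟩ ⟨e.1 + 1, e.2.2.2⟩ 1 := by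
  obtain ⟨k, s, a, b⟩ := e
  simp only [siteMatrix, Pi.add_apply, Pi.smul_apply, smul_eq_mul, mul_add, add_smul,
    Finset.sum_add_distrib, add_right_inj]
  rw [Finset.sum_eq_single s, Finset.sum_eq_single a, Finset.sum_eq_single b]
  · simp [mul_comm]
  all_goals simp +contextual [Pi.single_apply]

lemma siteMatrix_add_single_of_ne (f : ∀ i, Fin (d i) → ℝ) (A : MPSIndex d α → ℝ)
    (e : MPSIndex d α) (t : ℝ) {k : Fin n} (hk : k ≠ e.1) :
    siteMatrix f (A + t • Pi.single e 1) k = siteMatrix f A k := by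
  simp only [siteMatrix, Pi.add_apply, Pi.smul_apply, smul_eq_mul]
  refine Finset.sum_congr rfl fun s _ => Finset.sum_congr rfl fun a _ =>
    Finset.sum_congr rfl fun b _ => ?_
  rw [Pi.single_eq_of_ne, mul_zero, add_zero]
  rintro rfl
  exact hk rfl

lemma differentiable_mpsOutput {X : Type*} (φ : ∀ i, X → Fin (d i) → ℝ) (x : Fin n → X) :
    Differentiable ℝ (mpsOutput (α := α) φ x) := by
  unfold mpsOutput
  fun_prop

/-- With the cycle based at `e.1`, the entry `e` occurs in the first factor only, and the trace
against a matrix unit picks out one entry of the complementary arc. -/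
lemma mpsOutput_add_single {X : Type*} (φ : ∀ i, X → Fin (d i) → ℝ) (x : Fin n → X)
    (A : MPSIndex d α → ℝ) (e : MPSIndex d α) (t : ℝ) :
    mpsOutput φ x (A + t • Pi.single e 1) = mpsOutput φ x A + t * (φ e.1 (x e.1) e.2.1 *
      arcProd (siteMatrix (fun i => φ i (x i)) A) (n - 1) (e.1 + 1)
        ⟨e.1 + 1, e.2.2.2⟩ ⟨e.1, e.2.2.1⟩) := by
  rw [mpsOutput_eq_trace φ x _ e.1, mpsOutput_eq_trace φ x _ e.1]
  rw [arcProd_cycle, arcProd_cycle, siteMatrix_add_single, add_mul, trace_add]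
  have hc : arcProd (siteMatrix (fun i => φ i (x i)) (A + t • Pi.single e 1)) (n - 1) (e.1 + 1)
      = arcProd (siteMatrix (fun i => φ i (x i)) A) (n - 1) (e.1 + 1) :=
    arcProd_congr fun i hi => siteMatrix_add_single_of_ne _ A e t
      (siteShift_ne_self (r := i + 1) (Nat.succ_pos i) (by omega) e.1)
  rw [hc, smul_mul_assoc, trace_smul, trace_single_mul]
  simp [mul_assoc]

lemma fderiv_mpsOutput_single {X : Type*} (φ : ∀ i, X → Fin (d i) → ℝ) (x : Fin n → X)
    (A : MPSIndex d α → ℝ) (e : MPSIndex d α) :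
    fderiv ℝ (mpsOutput φ x) A (Pi.single e 1) = φ e.1 (x e.1) e.2.1 *
      arcProd (siteMatrix (fun i => φ i (x i)) A) (n - 1) (e.1 + 1)
        ⟨e.1 + 1, e.2.2.2⟩ ⟨e.1, e.2.2.1⟩ := by
  have h1 := ((differentiable_mpsOutput φ x A).hasFDerivAt.hasLineDerivAt (Pi.single e 1))
  unfold HasLineDerivAt at h1
  simp only [mpsOutput_add_single] at h1
  refine h1.unique ?_
  simpa using ((hasDerivAt_id (0 : ℝ)).mul_const _).const_add (mpsOutput φ x A)

end Arcs

/-! ### Fourth-moment bounds for products of Gaussian matrices -/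

section FourthMoments

open Matrix

variable {S : Type*} [Fintype S]

/-- The fourth power of the Schatten 4-norm of `W`. -/
def schattenFour (W : Matrix S S ℝ) : ℝ := ∑ p, ∑ q, (W * Wᵀ) p q ^ 2

/-- The fourth power of the Frobenius norm of `W`. -/
def frobeniusFour (W : Matrix S S ℝ) : ℝ := (∑ p, (W * Wᵀ) p p) ^ 2

lemma schattenFour_nonneg (W : Matrix S S ℝ) : 0 ≤ schattenFour W :=
  Finset.sum_nonneg fun _ _ => Finset.sum_nonneg fun _ _ => sq_nonneg _

lemma frobeniusFour_nonneg (W : Matrix S S ℝ) : 0 ≤ frobeniusFour W := sq_nonneg _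

lemma mul_transpose_self_apply_self_nonneg (W : Matrix S S ℝ) (p : S) : 0 ≤ (W * Wᵀ) p p := by
  rw [mul_apply]
  exact Finset.sum_nonneg fun i _ => by rw [transpose_apply]; exact mul_self_nonneg _

lemma sq_mul_transpose_self_apply_le (W : Matrix S S ℝ) (p q : S) :
    (W * Wᵀ) p q ^ 2 ≤ (W * Wᵀ) p p * (W * Wᵀ) q q := by
  simp only [mul_apply, transpose_apply]
  have := Finset.sum_mul_sq_le_sq_mul_sq Finset.univ (fun i => W p i) (fun i => W q i)
  simpa [sq] using this

lemma schattenFour_le_frobeniusFour (W : Matrix S S ℝ) : schattenFour W ≤ frobeniusFour W := by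
  rw [schattenFour, frobeniusFour, sq, Finset.sum_mul_sum]
  exact Finset.sum_le_sum fun p _ => Finset.sum_le_sum fun q _ =>
    sq_mul_transpose_self_apply_le W p q

open scoped Matrix.Norms.L2Operator in
lemma sq_l2_opNorm_le_sum_sq [DecidableEq S] (M : Matrix S S ℝ) :
    ‖M‖ ^ 2 ≤ ∑ p, ∑ q, M p q ^ 2 := by
  have h0 : 0 ≤ ∑ p, ∑ q, M p q ^ 2 :=
    Finset.sum_nonneg fun _ _ => Finset.sum_nonneg fun _ _ => sq_nonneg _
  rw [← Real.le_sqrt (norm_nonneg _) h0, cstar_norm_def]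
  refine ContinuousLinearMap.opNorm_le_bound _ (Real.sqrt_nonneg _) fun x => ?_
  rw [EuclideanSpace.norm_eq, EuclideanSpace.norm_eq, ← Real.sqrt_mul h0]
  refine Real.sqrt_le_sqrt ?_
  rw [Finset.sum_mul]
  refine Finset.sum_le_sum fun p _ => ?_
  simp only [Real.norm_eq_abs, sq_abs, ofLp_toEuclideanCLM, mulVec, dotProduct]
  exact Finset.sum_mul_sq_le_sq_mul_sq _ _ _

open scoped Matrix.Norms.L2Operator in
-- The operator norm is reached through a quartic polynomial in the entries, whose Gaussian
-- expectation is computable.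
lemma l2_opNorm_pow_four_le_schattenFour [DecidableEq S] (W : Matrix S S ℝ) :
    ‖W‖ ^ 4 ≤ schattenFour W := by
  have h : ‖W‖ ^ 2 = ‖W * Wᵀ‖ := by
    have := CStarRing.norm_self_mul_star (x := W)
    rw [sq, ← this, star_eq_conjTranspose, conjTranspose_eq_transpose_of_trivial]
  calc ‖W‖ ^ 4 = ‖W * Wᵀ‖ ^ 2 := by rw [← h]; ring
    _ ≤ _ := sq_l2_opNorm_le_sum_sq _

/-! ### Fourth moments after multiplication by a Gaussian matrix. -/

variable {E : Type*} [Fintype E]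

/-- The random matrix with the entries `t p i ⬝ᵥ x`. -/
def linearMatrix (t : S → S → E → ℝ) (x : E → ℝ) : Matrix S S ℝ := of fun p i => t p i ⬝ᵥ x

lemma linearMatrix_mul_apply (t : S → S → E → ℝ) (W : Matrix S S ℝ) (x : E → ℝ) (p q : S) :
    ((linearMatrix t x * W) * (linearMatrix t x * W)ᵀ) p q =
      ∑ i, ∑ j, (W * Wᵀ) i j * ((t p i ⬝ᵥ x) * (t q j ⬝ᵥ x)) := by
  rw [transpose_mul, mul_assoc, ← mul_assoc W, mul_apply]
  refine Finset.sum_congr rfl fun i _ => ?_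
  rw [mul_apply, Finset.mul_sum]
  refine Finset.sum_congr rfl fun j _ => ?_
  simp only [linearMatrix, of_apply, transpose_apply]
  ring

lemma linearMatrix_mul_apply_mul (t : S → S → E → ℝ) (W : Matrix S S ℝ) (x : E → ℝ)
    (p q p' q' : S) :
    ((linearMatrix t x * W) * (linearMatrix t x * W)ᵀ) p q *
      ((linearMatrix t x * W) * (linearMatrix t x * W)ᵀ) p' q' =
      ∑ i, ∑ k, ∑ j, ∑ l, ((W * Wᵀ) i j * (W * Wᵀ) k l) *
        ((t p i ⬝ᵥ x) * (t q j ⬝ᵥ x) * (t p' k ⬝ᵥ x) * (t q' l ⬝ᵥ x)) := by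
  rw [linearMatrix_mul_apply, linearMatrix_mul_apply, Finset.sum_mul_sum]
  refine Finset.sum_congr rfl fun i _ => Finset.sum_congr rfl fun k _ => ?_
  rw [Finset.sum_mul_sum]
  exact Finset.sum_congr rfl fun j _ => Finset.sum_congr rfl fun l _ => by ring

lemma integrable_linearMatrix_mul_apply_mul (v : E → ℝ≥0) (t : S → S → E → ℝ) (W : Matrix S S ℝ)
    (p q p' q' : S) :
    Integrable (fun x => ((linearMatrix t x * W) * (linearMatrix t x * W)ᵀ) p q *
      ((linearMatrix t x * W) * (linearMatrix t x * W)ᵀ) p' q') (gaussianProduct v) := by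
  simp only [linearMatrix_mul_apply_mul]
  exact integrable_finsetSum _ fun i _ => integrable_finsetSum _ fun k _ =>
    integrable_finsetSum _ fun j _ => integrable_finsetSum _ fun l _ =>
      (integrable_linear_quartic_gaussianProduct v _ _ _ _).const_mul _

/-- The entries of `linearMatrix t` are uncorrelated, of variance `c` in the rows where `χ` is `1`
and the columns where `χ'` is `1`, and `0` elsewhere. -/
structure IsBlockCov [DecidableEq S] (v : E → ℝ≥0) (t : S → S → E → ℝ) (c : ℝ) (χ χ' : S → ℝ) :
    Prop where
  cov : ∀ p i q j, gaussianCov v (t p i) (t q j) =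
    c * (if p = q then χ p else 0) * (if i = j then χ' i else 0)
  left : ∀ p, χ p = 0 ∨ χ p = 1
  right : ∀ p, χ' p = 0 ∨ χ' p = 1

variable [DecidableEq S]

/-- Of the three Wick pairings, the one inside each Gram entry gives the squared trace of `W * Wᵀ`
over the block. The two that cross between the Gram entries give its sum of squares. -/
lemma IsBlockCov.integral_mul {v : E → ℝ≥0} {t : S → S → E → ℝ} {c : ℝ} {χ χ' : S → ℝ}
    (h : IsBlockCov v t c χ χ') (W : Matrix S S ℝ) (p q p' q' : S) :
    ∫ x, ((linearMatrix t x * W) * (linearMatrix t x * W)ᵀ) p q *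
      ((linearMatrix t x * W) * (linearMatrix t x * W)ᵀ) p' q' ∂gaussianProduct v =
    c ^ 2 * ((if p = q then χ p else 0) * (if p' = q' then χ p' else 0) *
        (∑ i, χ' i * (W * Wᵀ) i i) ^ 2
      + ((if p = p' then χ p else 0) * (if q = q' then χ q else 0)
        + (if p = q' then χ p else 0) * (if q = p' then χ q else 0)) *
        ∑ i, ∑ j, χ' i * χ' j * (W * Wᵀ) i j ^ 2) := by
  have hi : ∀ i k j l, Integrable (fun x => ((W * Wᵀ) i j * (W * Wᵀ) k l) *
      ((t p i ⬝ᵥ x) * (t q j ⬝ᵥ x) * (t p' k ⬝ᵥ x) * (t q' l ⬝ᵥ x))) (gaussianProduct v) :=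
    fun i k j l => (integrable_linear_quartic_gaussianProduct v _ _ _ _).const_mul _
  simp_rw [linearMatrix_mul_apply_mul]
  rw [integral_finsetSum _ fun i _ => integrable_finsetSum _ fun k _ =>
    integrable_finsetSum _ fun j _ => integrable_finsetSum _ fun l _ => hi i k j l]
  simp_rw [fun i => integral_finsetSum (μ := gaussianProduct v) Finset.univ fun k _ =>
    integrable_finsetSum Finset.univ fun j _ => integrable_finsetSum Finset.univ
      fun l _ => hi i k j l]
  simp_rw [fun i k => integral_finsetSum (μ := gaussianProduct v) Finset.univ fun j _ =>
    integrable_finsetSum Finset.univ fun l _ => hi i k j l]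
  simp_rw [fun i k j => integral_finsetSum (μ := gaussianProduct v) Finset.univ fun l _ =>
    hi i k j l]
  simp_rw [integral_const_mul, integral_linear_quartic_gaussianProduct, h.cov]
  -- Symmetry is needed for the last pairing, which produces the product of the entries `i j` and `j
  -- i`.
  have hsymm : ∀ i j, (W * Wᵀ) i j = (W * Wᵀ) j i := fun i j => by
    simp only [mul_apply, transpose_apply, mul_comm]
  clear hi
  generalize W * Wᵀ = Q at hsymm ⊢
  generalize (if p = q then χ p else 0) = a₁
  generalize (if p' = q' then χ p' else 0) = a₂
  generalize (if p = p' then χ p else 0) = a₃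
  generalize (if q = q' then χ q else 0) = a₄
  generalize (if p = q' then χ p else 0) = a₅
  generalize (if q = p' then χ q else 0) = a₆
  simp only [mul_add, add_mul, Finset.sum_add_distrib]
  rw [← add_assoc]
  congr 1
  · congr 1
    · simp only [mul_ite, ite_mul, zero_mul, mul_zero, Finset.sum_ite_eq, Finset.mem_univ, if_true]
      rw [sq (∑ i, _), Finset.sum_mul_sum]
      simp only [Finset.mul_sum]
      exact Finset.sum_congr rfl fun i _ => Finset.sum_congr rfl fun k _ => by ring
    · simp only [Finset.mul_sum]
      refine Finset.sum_congr rfl fun i _ => ?_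
      rw [Finset.sum_comm]
      refine Finset.sum_congr rfl fun j _ => ?_
      simp only [mul_ite, ite_mul, zero_mul, mul_zero, Finset.sum_ite_eq, Finset.mem_univ, if_true]
      ring
  · simp only [Finset.mul_sum]
    refine Finset.sum_congr rfl fun i _ => ?_
    rw [Finset.sum_comm]
    refine Finset.sum_congr rfl fun j _ => ?_
    simp only [mul_ite, ite_mul, zero_mul, mul_zero, Finset.sum_ite_eq, Finset.mem_univ, if_true,
      Finset.sum_ite_irrel, Finset.sum_const_zero]
    rw [hsymm j i]
    ring

omit [DecidableEq S] in
lemma IsBlockCov.sum_sq_le {χ' : S → ℝ} (h : ∀ p, χ' p = 0 ∨ χ' p = 1) (W : Matrix S S ℝ) :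
    ∑ i, ∑ j, χ' i * χ' j * (W * Wᵀ) i j ^ 2 ≤ schattenFour W := by
  refine Finset.sum_le_sum fun i _ => Finset.sum_le_sum fun j _ => ?_
  rcases h i with hi | hi <;> rcases h j with hj | hj <;> simp [hi, hj, sq_nonneg]

omit [DecidableEq S] in
lemma IsBlockCov.sq_sum_le {χ' : S → ℝ} (h : ∀ p, χ' p = 0 ∨ χ' p = 1) (W : Matrix S S ℝ) :
    (∑ i, χ' i * (W * Wᵀ) i i) ^ 2 ≤ frobeniusFour W := by
  have h0 := mul_transpose_self_apply_self_nonneg W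
  refine pow_le_pow_left₀ (Finset.sum_nonneg fun i _ => ?_) (Finset.sum_le_sum fun i _ => ?_) 2
  · rcases h i with hi | hi <;> simp [hi, h0]
  · rcases h i with hi | hi <;> simp [hi, h0]

omit [DecidableEq S] in
lemma IsBlockCov.sum_mul_self {χ : S → ℝ} (h : ∀ p, χ p = 0 ∨ χ p = 1) :
    ∑ p, χ p * χ p = ∑ p, χ p :=
  Finset.sum_congr rfl fun p _ => by rcases h p with hp | hp <;> simp [hp]

/-- The Frobenius term survives only on the diagonal `p = q`, so it has weight `β` rather than `β ^
2`. This missing factor `β` is the source of the decay. -/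
lemma IsBlockCov.lintegral_schattenFour_le {v : E → ℝ≥0} {t : S → S → E → ℝ} {c : ℝ}
    {χ χ' : S → ℝ} (h : IsBlockCov v t c χ χ') (W : Matrix S S ℝ) {β : ℝ} (hβ : ∑ p, χ p = β) :
    ∫⁻ x, ENNReal.ofReal (schattenFour (linearMatrix t x * W)) ∂gaussianProduct v ≤
      ENNReal.ofReal (c ^ 2 * ((β ^ 2 + β) * schattenFour W + β * frobeniusFour W)) := by
  have hβ0 : 0 ≤ β := hβ ▸ Finset.sum_nonneg fun p _ => by
    rcases h.left p with hp | hp <;> simp [hp]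
  have hi := fun p q => integrable_linearMatrix_mul_apply_mul v t W p q p q
  simp only [schattenFour, sq ((linearMatrix t _ * W * (linearMatrix t _ * W)ᵀ) _ _)]
  rw [← ofReal_integral_eq_lintegral_ofReal
    (integrable_finsetSum _ fun p _ => integrable_finsetSum _ fun q _ => hi p q)
    (ae_of_all _ fun x => Finset.sum_nonneg fun _ _ => Finset.sum_nonneg fun _ _ =>
      mul_self_nonneg _)]
  refine ENNReal.ofReal_le_ofReal ?_
  rw [integral_finsetSum _ fun p _ => integrable_finsetSum _ fun q _ => hi p q]
  simp_rw [fun p => integral_finsetSum (μ := gaussianProduct v) Finset.univ fun q _ => hi p q,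
    h.integral_mul, ← Finset.mul_sum]
  refine mul_le_mul_of_nonneg_left ?_ (sq_nonneg c)
  have hs := IsBlockCov.sum_sq_le h.right W
  have hf := IsBlockCov.sq_sum_le h.right W
  rw [schattenFour] at hs
  generalize ∑ i, ∑ j, χ' i * χ' j * (W * Wᵀ) i j ^ 2 = ρ at *
  generalize (∑ i, χ' i * (W * Wᵀ) i i) ^ 2 = τ at *
  have hsum : ∑ p, ∑ q, ((if p = q then χ p else 0) * (if p = q then χ p else 0) * τ
      + (χ p * χ q
        + (if p = q then χ p else 0) * (if q = p then χ q else 0)) * ρ)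
      = β * τ + (β ^ 2 + β) * ρ := by
    have hd : ∀ p q, (if p = q then χ p else 0) * (if q = p then χ q else 0)
        = if p = q then χ p * χ p else 0 := fun p q => by
      by_cases hpq : p = q
      · simp [hpq]
      · simp [hpq]
    have hd' : ∀ p q, (if p = q then χ p else 0) * (if p = q then χ p else 0)
        = if p = q then χ p * χ p else 0 := fun p q => by
      by_cases hpq : p = q <;> simp [hpq]
    simp only [hd, hd', if_true, Finset.sum_add_distrib, ← Finset.sum_mul, Finset.sum_ite_eq,
      Finset.mem_univ, IsBlockCov.sum_mul_self h.left, hβ, ← Finset.mul_sum, add_mul]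
    ring
  simp only [if_true]
  rw [hsum, add_comm]
  gcongr

/-- Here the roles are exchanged: the pairing within Gram entries is unrestricted and gives `β ^ 2`,
the two crossing ones force `p = q`. -/
lemma IsBlockCov.lintegral_frobeniusFour_le {v : E → ℝ≥0} {t : S → S → E → ℝ} {c : ℝ}
    {χ χ' : S → ℝ} (h : IsBlockCov v t c χ χ') (W : Matrix S S ℝ) {β : ℝ} (hβ : ∑ p, χ p = β) :
    ∫⁻ x, ENNReal.ofReal (frobeniusFour (linearMatrix t x * W)) ∂gaussianProduct v ≤
      ENNReal.ofReal (c ^ 2 * (β ^ 2 * frobeniusFour W + 2 * β * schattenFour W)) := by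
  have hβ0 : 0 ≤ β := hβ ▸ Finset.sum_nonneg fun p _ => by
    rcases h.left p with hp | hp <;> simp [hp]
  have hi := fun p q => integrable_linearMatrix_mul_apply_mul v t W p p q q
  simp only [frobeniusFour, sq (∑ p, (linearMatrix t _ * W * (linearMatrix t _ * W)ᵀ) p p)]
  rw [← ofReal_integral_eq_lintegral_ofReal
    ((integrable_finsetSum Finset.univ fun p _ => integrable_finsetSum Finset.univ
      fun q _ => hi p q).congr (ae_of_all _ fun x => (Finset.sum_mul_sum _ _ _ _).symm))
    (ae_of_all _ fun x => mul_self_nonneg _)]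
  refine ENNReal.ofReal_le_ofReal ?_
  simp only [Finset.sum_mul_sum]
  rw [integral_finsetSum _ fun p _ => integrable_finsetSum _ fun q _ => hi p q]
  simp_rw [fun p => integral_finsetSum (μ := gaussianProduct v) Finset.univ fun q _ => hi p q,
    h.integral_mul, ← Finset.mul_sum]
  refine mul_le_mul_of_nonneg_left ?_ (sq_nonneg c)
  have hs := IsBlockCov.sum_sq_le h.right W
  have hf := IsBlockCov.sq_sum_le h.right W
  rw [frobeniusFour] at hf
  generalize ∑ i, ∑ j, χ' i * χ' j * (W * Wᵀ) i j ^ 2 = ρ at *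
  generalize (∑ i, χ' i * (W * Wᵀ) i i) ^ 2 = τ at *
  have hsum : ∑ p, ∑ q, (χ p * χ q * τ
      + ((if p = q then χ p else 0) * (if p = q then χ p else 0)
        + (if p = q then χ p else 0) * (if p = q then χ p else 0)) * ρ)
      = β ^ 2 * τ + 2 * β * ρ := by
    have hd' : ∀ p q, (if p = q then χ p else 0) * (if p = q then χ p else 0)
        = if p = q then χ p * χ p else 0 := fun p q => by
      by_cases hpq : p = q <;> simp [hpq]
    simp only [hd', if_true, Finset.sum_add_distrib, ← Finset.sum_mul, Finset.sum_ite_eq,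
      Finset.mem_univ, IsBlockCov.sum_mul_self h.left, hβ, ← Finset.mul_sum, add_mul]
    ring
  simp only [if_true]
  rw [hsum]
  gcongr

end FourthMoments

/-! ### Moments of the products along arcs at a Gaussian initialization -/

section ArcMoments

open Matrix

variable {n : ℕ} [NeZero n] {d α : Fin n → ℕ}

/-- The entry `p i` of the site matrix at `k`, as a linear form in the tensors. -/
def siteForm (α : Fin n → ℕ) (f : ∀ i, Fin (d i) → ℝ) (k : Fin n) (p i : BondIndex α)
    (e : MPSIndex d α) : ℝ :=
  if e.1 = k ∧ p = ⟨e.1, e.2.2.1⟩ ∧ i = ⟨e.1 + 1, e.2.2.2⟩ then f e.1 e.2.1 else 0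

lemma siteForm_eq_zero_left (f : ∀ i, Fin (d i) → ℝ) {k : Fin n} {p : BondIndex α}
    (hp : p.1 ≠ k) (i : BondIndex α) : siteForm α f k p i = 0 := by
  funext e
  refine if_neg ?_
  rintro ⟨rfl, rfl, -⟩
  exact hp rfl

lemma siteForm_eq_zero_right (f : ∀ i, Fin (d i) → ℝ) {k : Fin n} (p : BondIndex α)
    {i : BondIndex α} (hi : i.1 ≠ k + 1) : siteForm α f k p i = 0 := by
  funext e
  refine if_neg ?_
  rintro ⟨rfl, -, rfl⟩
  exact hi rfl

lemma sum_siteForm_mul (f : ∀ i, Fin (d i) → ℝ) (k : Fin n) (a : Fin (α k))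
    (b : Fin (α (k + 1))) (g : MPSIndex d α → ℝ) :
    ∑ e, siteForm α f k ⟨k, a⟩ ⟨k + 1, b⟩ e * g e = ∑ s, f k s * g ⟨k, s, a, b⟩ := by
  rw [Fintype.sum_sigma, Finset.sum_eq_single k]
  · simp only [Fintype.sum_prod_type]
    refine Finset.sum_congr rfl fun s _ => ?_
    rw [Finset.sum_eq_single a, Finset.sum_eq_single b]
    · simp [siteForm]
    all_goals simp +contextual [siteForm, eq_comm]
  · intro k' _ hk'
    simp [siteForm, hk']
  · simp

lemma siteMatrix_eq_linearMatrix (f : ∀ i, Fin (d i) → ℝ) (A : MPSIndex d α → ℝ) (k : Fin n) :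
    siteMatrix f A k = linearMatrix (siteForm α f k) A := by
  have hN := isBlockSupported_siteMatrix f A k
  ext p i
  rw [linearMatrix, of_apply]
  by_cases hp : p.1 = k
  · by_cases hi : i.1 = k + 1
    · obtain ⟨k, a⟩ := p
      obtain ⟨_, b⟩ := i
      subst hp hi
      rw [siteMatrix_apply, dotProduct, sum_siteForm_mul]
    · rw [hN.2 p i hi, siteForm_eq_zero_right f p hi, zero_dotProduct]
  · rw [hN.1 p i hp, siteForm_eq_zero_left f hp, zero_dotProduct]

lemma isBlockCov_siteForm (f : ∀ i, Fin (d i) → ℝ) (ν : Fin n → ℝ≥0) (k : Fin n) :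
    IsBlockCov (fun e : MPSIndex d α => ν e.1) (siteForm α f k) (ν k * ∑ s, f k s ^ 2)
      (fun p => if p.1 = k then 1 else 0) (fun p => if p.1 = k + 1 then 1 else 0) where
  left p := by by_cases h : p.1 = k <;> simp [h]
  right p := by by_cases h : p.1 = k + 1 <;> simp [h]
  cov p i q j := by
    unfold gaussianCov
    by_cases hp : p.1 = k
    · by_cases hi : i.1 = k + 1
      · obtain ⟨k, a⟩ := p
        obtain ⟨_, b⟩ := i
        subst hp hi
        simp only [mul_assoc, sum_siteForm_mul]
        by_cases hq : (⟨k, a⟩ : BondIndex α) = q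
        · by_cases hj : (⟨k + 1, b⟩ : BondIndex α) = j
          · subst hq hj
            simp only [siteForm, and_self, if_true, mul_one, Finset.mul_sum]
            exact Finset.sum_congr rfl fun s _ => by ring
          · simp [siteForm, hj, Ne.symm hj]
        · simp [siteForm, hq, Ne.symm hq]
      · simp [siteForm_eq_zero_right f p hi, hi]
    · simp [siteForm_eq_zero_left f hp, hp]

omit [NeZero n] in
lemma sum_block_indicator (k : Fin n) :
    ∑ p : BondIndex α, (if p.1 = k then (1 : ℝ) else 0) = α k := by
  rw [Fintype.sum_sigma, Finset.sum_eq_single k]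
  · simp
  · intro i _ hi; simp [hi]
  · simp

omit [NeZero n] in
lemma bondProj_mul_transpose (k : Fin n) : bondProj α k * (bondProj α k)ᵀ = bondProj α k := by
  simp [bondProj]

omit [NeZero n] in
lemma schattenFour_bondProj (k : Fin n) : schattenFour (bondProj α k) = α k := by
  rw [schattenFour, bondProj_mul_transpose, ← sum_block_indicator]
  refine Finset.sum_congr rfl fun p _ => ?_
  simp [bondProj, diagonal_apply, ite_pow]

omit [NeZero n] in
lemma frobeniusFour_bondProj (k : Fin n) : frobeniusFour (bondProj α k) = α k ^ 2 := by
  rw [frobeniusFour, bondProj_mul_transpose, ← sum_block_indicator]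
  simp [bondProj]

lemma continuous_siteMatrix (f : ∀ i, Fin (d i) → ℝ) (k : Fin n) :
    Continuous fun A : MPSIndex d α → ℝ => siteMatrix f A k := by
  unfold siteMatrix
  fun_prop

lemma continuous_arcProd_siteMatrix (f : ∀ i, Fin (d i) → ℝ) (r : ℕ) (k : Fin n) :
    Continuous fun A : MPSIndex d α → ℝ => arcProd (siteMatrix f A) r k := by
  induction r generalizing k with
  | zero => exact continuous_const
  | succ r ih => exact (continuous_siteMatrix f k).matrix_mul (ih (k + 1))

lemma continuous_schattenFour {S : Type*} [Fintype S] :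
    Continuous (schattenFour : Matrix S S ℝ → ℝ) := by
  unfold schattenFour
  fun_prop

lemma continuous_frobeniusFour {S : Type*} [Fintype S] :
    Continuous (frobeniusFour : Matrix S S ℝ → ℝ) := by
  unfold frobeniusFour
  fun_prop

/-- As `r < n`, site `k` does not recur in the rest of the arc, so its tensor can be resampled
independently. The rest `A'` is then frozen while the first factor is averaged. -/
lemma lintegral_arcProd_succ (f : ∀ i, Fin (d i) → ℝ) (v : MPSIndex d α → ℝ≥0)
    {F : Matrix (BondIndex α) (BondIndex α) ℝ → ℝ} (hF : Continuous F) {r : ℕ} (hr : r < n)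
    (k : Fin n) :
    ∫⁻ A, ENNReal.ofReal (F (arcProd (siteMatrix f A) (r + 1) k)) ∂gaussianProduct v =
      ∫⁻ A', ∫⁻ A, ENNReal.ofReal (F (linearMatrix (siteForm α f k) A *
        arcProd (siteMatrix f A') r (k + 1))) ∂gaussianProduct v ∂gaussianProduct v := by
  have hm : Measurable fun A : MPSIndex d α → ℝ =>
      ENNReal.ofReal (F (arcProd (siteMatrix f A) (r + 1) k)) :=
    (hF.comp (continuous_arcProd_siteMatrix f (r + 1) k)).measurable.ennreal_ofReal
  have hp := measurePreserving_resample v (fun e : MPSIndex d α => e.1 = k)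
  rw [← hp.lintegral_comp hm]
  refine (lintegral_prod_symm' _ (hm.comp hp.measurable)).trans ?_
  refine lintegral_congr fun A' => lintegral_congr fun A => ?_
  have h1 : siteMatrix f (fun e => if e.1 = k then A e else A' e) k = siteMatrix f A k := by
    simp [siteMatrix]
  have h2 : arcProd (siteMatrix f (fun e => if e.1 = k then A e else A' e)) r (k + 1) =
      arcProd (siteMatrix f A') r (k + 1) := by
    refine arcProd_congr fun i hi => ?_
    have := siteShift_ne_self (r := i + 1) (Nat.succ_pos i) (by omega) k
    rw [siteShift] at this
    simp [siteMatrix, this]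
  change ENNReal.ofReal (F (siteMatrix f (fun e => if e.1 = k then A e else A' e) k *
    arcProd (siteMatrix f (fun e => if e.1 = k then A e else A' e)) r (k + 1))) = _
  rw [h1, h2, siteMatrix_eq_linearMatrix]

lemma lintegral_ofReal_add_le {Ω : Type*} [MeasurableSpace Ω] {μ : Measure Ω} {F G : Ω → ℝ}
    (hF : Measurable F) (hF0 : ∀ ω, 0 ≤ F ω) (hG0 : ∀ ω, 0 ≤ G ω)
    {a b X Y : ℝ} (ha : 0 ≤ a) (hb : 0 ≤ b) (hX0 : 0 ≤ X) (hY0 : 0 ≤ Y)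
    (hX : ∫⁻ ω, ENNReal.ofReal (F ω) ∂μ ≤ ENNReal.ofReal X)
    (hY : ∫⁻ ω, ENNReal.ofReal (G ω) ∂μ ≤ ENNReal.ofReal Y) :
    ∫⁻ ω, ENNReal.ofReal (a * F ω + b * G ω) ∂μ ≤ ENNReal.ofReal (a * X + b * Y) := by
  have h : ∀ ω, ENNReal.ofReal (a * F ω + b * G ω) =
      ENNReal.ofReal a * ENNReal.ofReal (F ω) + ENNReal.ofReal b * ENNReal.ofReal (G ω) := by
    intro ω
    rw [ENNReal.ofReal_add (mul_nonneg ha (hF0 ω)) (mul_nonneg hb (hG0 ω)),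
      ENNReal.ofReal_mul ha, ENNReal.ofReal_mul hb]
  simp_rw [h]
  rw [lintegral_add_left (hF.ennreal_ofReal.const_mul _),
    lintegral_const_mul' _ _ ENNReal.ofReal_ne_top, lintegral_const_mul' _ _ ENNReal.ofReal_ne_top,
    ENNReal.ofReal_add (mul_nonneg ha hX0) (mul_nonneg hb hY0), ENNReal.ofReal_mul ha,
    ENNReal.ofReal_mul hb]
  gcongr

/-- Both bounds are proved together because the recursions for the two norms are coupled. The small
factor `θ` (at least every `1 / α k`) enters at length 0, where the Schatten quantity is `α k` and
the Frobenius one `α k ^ 2`, and it is propagated by the recursion. -/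
lemma lintegral_arcProd_le (f : ∀ i, Fin (d i) → ℝ) (ν : Fin n → ℝ≥0) {V θ : ℝ}
    (hα : ∀ k, 1 ≤ α k)
    (hV : ∀ k, (ν k * ∑ s, f k s ^ 2) ^ 2 * (α k * α (k + 1)) ≤ V)
    (hθ : ∀ k, 1 ≤ θ * α k) {r : ℕ} (hr : r ≤ n) (k : Fin n) :
    ∫⁻ A, ENNReal.ofReal (schattenFour (arcProd (siteMatrix f A) r k))
        ∂gaussianProduct (fun e : MPSIndex d α => ν e.1) ≤
      ENNReal.ofReal (θ * ((3 * V) ^ r * (α k * α (siteShift r k)))) ∧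
    ∫⁻ A, ENNReal.ofReal (frobeniusFour (arcProd (siteMatrix f A) r k))
        ∂gaussianProduct (fun e : MPSIndex d α => ν e.1) ≤
      ENNReal.ofReal ((3 * V) ^ r * (α k * α (siteShift r k))) := by
  have hV0 : 0 ≤ V := le_trans (by positivity) (hV k)
  have hθ0 : 0 ≤ θ := by
    by_contra h
    have := hθ k
    nlinarith [mul_nonneg (neg_nonneg.2 (not_le.1 h).le) (Nat.cast_nonneg (α := ℝ) (α k))]
  induction r generalizing k with
  | zero =>
    simp only [arcProd, schattenFour_bondProj, frobeniusFour_bondProj, lintegral_const,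
      measure_univ, mul_one, pow_zero, one_mul, siteShift]
    refine ⟨ENNReal.ofReal_le_ofReal ?_, ENNReal.ofReal_le_ofReal (sq _).le⟩
    have := mul_le_mul_of_nonneg_right (hθ k) (Nat.cast_nonneg (α := ℝ) (α k))
    linarith
  | succ r ih =>
    obtain ⟨ih1, ih2⟩ := ih (by omega) (k + 1)
    -- In the Frobenius recursion the Schatten term has only weight `2 β`, so bounding it by the
    -- Frobenius term loses nothing essential.
    have ih3 : ∫⁻ A, ENNReal.ofReal (schattenFour (arcProd (siteMatrix f A) r (k + 1)))
        ∂gaussianProduct (fun e : MPSIndex d α => ν e.1) ≤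
        ENNReal.ofReal ((3 * V) ^ r * (α (k + 1) * α (siteShift r (k + 1)))) :=
      (lintegral_mono fun A => ENNReal.ofReal_le_ofReal (schattenFour_le_frobeniusFour _)).trans ih2
    have hcov := isBlockCov_siteForm (α := α) f ν k
    have hm1 : Measurable fun A : MPSIndex d α → ℝ =>
        schattenFour (arcProd (siteMatrix f A) r (k + 1)) :=
      (continuous_schattenFour.comp (continuous_arcProd_siteMatrix f r (k + 1))).measurable
    have hm2 : Measurable fun A : MPSIndex d α → ℝ =>
        frobeniusFour (arcProd (siteMatrix f A) r (k + 1)) :=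
      (continuous_frobeniusFour.comp (continuous_arcProd_siteMatrix f r (k + 1))).measurable
    have hVk := hV k
    have hθk := hθ k
    have hβ1 : (1 : ℝ) ≤ α k := by exact_mod_cast hα k
    set c := ν k * ∑ s, f k s ^ 2
    set β := (α k : ℝ)
    set γ := (α (k + 1) : ℝ)
    have hγ0 : 0 ≤ γ := Nat.cast_nonneg _
    have hend : siteShift (r + 1) k = siteShift r (k + 1) := rfl
    rw [hend]
    set ξ := (α (siteShift r (k + 1)) : ℝ)
    have hξ0 : 0 ≤ ξ := Nat.cast_nonneg _
    have hB0 : 0 ≤ (3 * V) ^ r := by positivity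
    rw [lintegral_arcProd_succ f _ continuous_schattenFour (by omega),
      lintegral_arcProd_succ f _ continuous_frobeniusFour (by omega)]
    constructor
    · refine (lintegral_mono fun A' => hcov.lintegral_schattenFour_le _
        (sum_block_indicator k)).trans ?_
      simp_rw [mul_add (c ^ 2), ← mul_assoc (c ^ 2)]
      refine (lintegral_ofReal_add_le hm1 (fun _ => schattenFour_nonneg _)
        (fun _ => frobeniusFour_nonneg _) (by positivity) (by positivity) (by positivity)
        (by positivity) ih1 ih2).trans (ENNReal.ofReal_le_ofReal ?_)
      -- The factor 3 comes from `θ β + θ + 1 ≤ 3 θ β`, by `1 ≤ β` and `1 ≤ θ β`.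
      calc c ^ 2 * (β ^ 2 + β) * (θ * ((3 * V) ^ r * (γ * ξ))) + c ^ 2 * β * ((3 * V) ^ r * (γ * ξ))
          = (c ^ 2 * (β * γ)) * ((3 * V) ^ r * ξ) * (θ * β + θ * 1 + 1) := by ring
        _ ≤ V * ((3 * V) ^ r * ξ) * (θ * β + θ * β + θ * β) := by gcongr
        _ = _ := by ring
    · refine (lintegral_mono fun A' => hcov.lintegral_frobeniusFour_le _
        (sum_block_indicator k)).trans ?_
      simp_rw [mul_add (c ^ 2), ← mul_assoc (c ^ 2)]
      refine (lintegral_ofReal_add_le hm2 (fun _ => frobeniusFour_nonneg _)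
        (fun _ => schattenFour_nonneg _) (by positivity) (by positivity) (by positivity)
        (by positivity) ih2 ih3).trans (ENNReal.ofReal_le_ofReal ?_)
      calc c ^ 2 * β ^ 2 * ((3 * V) ^ r * (γ * ξ)) + c ^ 2 * 2 * β * ((3 * V) ^ r * (γ * ξ))
          = (c ^ 2 * (β * γ)) * ((3 * V) ^ r * ξ) * (β + 2 * 1) := by ring
        _ ≤ V * ((3 * V) ^ r * ξ) * (β + 2 * β) := by gcongr
        _ = _ := by ring

end ArcMoments

/-! ### Stability of the arc products along the gradient flow -/

section Flow

open Matrix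
open scoped Matrix.Norms.L2Operator

/-- A function whose speed is at most `B * D` moves by at most `B * C` if `D` has integral at
most `C`. -/
lemma norm_sub_le_of_speed_le {F : Type*} [NormedAddCommGroup F] [NormedSpace ℝ F] {f f' : ℝ → F}
    {D : ℝ → ℝ} {T t B C : ℝ} (ht : t ∈ Set.Icc 0 T)
    (hf : ∀ s ∈ Set.Icc 0 T, HasDerivWithinAt f (f' s) (Set.Icc 0 T) s)
    (hD0 : ∀ s, 0 ≤ D s) (hDi : IntegrableOn D (Set.Icc 0 T))
    (hDC : ∫ s in Set.Icc 0 T, D s ≤ C) (hB : 0 ≤ B)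
    (hle : ∀ s ∈ Set.Ico 0 t, ‖f' s‖ ≤ B * D s) :
    ‖f t - f 0‖ ≤ B * C := by
  have hsub : Set.Icc 0 t ⊆ Set.Icc 0 T := Set.Icc_subset_Icc_right ht.2
  have hd : ∀ s ∈ Set.Ioo 0 t, HasDerivAt f (f' s) s := fun s hs =>
    (hf s (hsub (Set.Ioo_subset_Icc_self hs))).hasDerivAt
      (Icc_mem_nhds hs.1 (hs.2.trans_le ht.2))
  have hi : IntervalIntegrable (fun s => B * D s) volume 0 t :=
    (intervalIntegrable_iff_integrableOn_Icc_of_le ht.1).2 ((hDi.mono_set hsub).const_mul B)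
  refine (norm_sub_le_integral_of_norm_deriv_le_of_le (B := fun s => B * D s) ht.1
    (fun s hs => ((hf s (hsub hs)).continuousWithinAt).mono hsub)
    (fun s hs => (hd s hs).differentiableAt.differentiableWithinAt)
    (ae_of_all _ fun s hs => ?_) hi).trans ?_
  · rw [(hd s hs).deriv]
    exact hle s (Set.Ioo_subset_Ico_self hs)
  · rw [intervalIntegral.integral_const_mul, intervalIntegral.integral_of_le ht.1,
      ← integral_Icc_eq_integral_Ioc]
    refine mul_le_mul_of_nonneg_left (le_trans ?_ hDC) hB
    exact setIntegral_mono_set hDi (ae_of_all _ hD0) hsub.eventuallyLE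

/-- A continuity argument: finitely many continuous functions that stay below `M` as long as they
have been at most `M` before stay below `M` forever. -/
lemma lt_of_continuity_argument {κ : Type*} [Finite κ] {G : κ → ℝ → ℝ} {T M : ℝ}
    (hG : ∀ i, ContinuousOn (G i) (Set.Icc 0 T))
    (h : ∀ t ∈ Set.Icc 0 T, (∀ s ∈ Set.Ico 0 t, ∀ i, G i s ≤ M) → ∀ i, G i t < M) :
    ∀ t ∈ Set.Icc 0 T, ∀ i, G i t < M := by
  by_contra! hne
  -- The times at which some function has reached `M` form a compact set, whose least element
  -- contradicts `h`. At `t = 0` the premise of `h` is vacuous, so `h` contains the initial bound.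
  have hcl : IsClosed (⋃ i, Set.Icc 0 T ∩ G i ⁻¹' Set.Ici M) :=
    isClosed_iUnion_of_finite fun i =>
      (hG i).preimage_isClosed_of_isClosed isClosed_Icc isClosed_Ici
  have hcomp : IsCompact (⋃ i, Set.Icc 0 T ∩ G i ⁻¹' Set.Ici M) :=
    isCompact_Icc.of_isClosed_subset hcl (Set.iUnion_subset fun i => Set.inter_subset_left)
  obtain ⟨t, ht, i, hi⟩ := hne
  obtain ⟨t₀, ht₀, hmin⟩ := hcomp.exists_isLeast ⟨t, Set.mem_iUnion.2 ⟨i, ht, hi⟩⟩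
  obtain ⟨i₀, ht₀T, hi₀⟩ := Set.mem_iUnion.1 ht₀
  refine absurd (h t₀ ht₀T (fun s hs j => ?_) i₀) (not_lt.2 hi₀)
  by_contra! hj
  exact absurd (hmin (Set.mem_iUnion.2 ⟨j, ⟨hs.1, hs.2.le.trans ht₀T.2⟩, hj.le⟩)) (not_le.2 hs.2)

lemma abs_apply_le_l2_opNorm {S : Type*} [Fintype S] [DecidableEq S] (W : Matrix S S ℝ) (p q : S) :
    |W p q| ≤ ‖W‖ := by
  have h := l2_opNorm_mulVec W (EuclideanSpace.single q 1)
  rw [PiLp.norm_single, norm_one, mul_one] at h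
  refine le_trans ?_ ((PiLp.norm_apply_le _ p).trans h)
  simp [Real.norm_eq_abs]

variable {n : ℕ} [NeZero n] {d α : Fin n → ℕ}

lemma hasDerivWithinAt_arcProd {N : ℝ → Fin n → Matrix (BondIndex α) (BondIndex α) ℝ}
    {N' : Fin n → Matrix (BondIndex α) (BondIndex α) ℝ} {s : Set ℝ} {t : ℝ}
    (hN : ∀ k, HasDerivWithinAt (fun r => N r k) (N' k) s t)
    (hb : IsBlockSupported N') (r : ℕ) (k : Fin n) :
    HasDerivWithinAt (fun u => arcProd (N u) r k)
      (∑ i ∈ Finset.range r, arcProd (N t) i k * N' (siteShift i k) *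
        arcProd (N t) (r - 1 - i) (siteShift (i + 1) k)) s t := by
  induction r generalizing k with
  | zero => simpa [arcProd] using hasDerivWithinAt_const t s (bondProj α k)
  | succ r ih =>
    refine ((hN k).mul (ih (k + 1))).congr_deriv ?_
    rw [Finset.sum_range_succ', add_comm, Finset.mul_sum]
    congr 1
    · refine Finset.sum_congr rfl fun i _ => ?_
      have h : r + 1 - 1 - (i + 1) = r - 1 - i := by omega
      rw [h]
      simp only [arcProd, siteShift, mul_assoc]
    -- The term `i = 0` carries an empty arc, that is, a projection, which the block support of `N'`
    -- absorbs.
    · simp only [arcProd, siteShift, hb.proj_mul]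
      rfl

/-- The fourth root of the bond dimension at the site `k`. -/
noncomputable def bondWeight (α : Fin n → ℕ) (k : Fin n) : ℝ := √√(α k)

omit [NeZero n] in
lemma bondWeight_pow_four (k : Fin n) : bondWeight α k ^ 4 = α k := by
  have h : bondWeight α k ^ 4 = (√√(α k) ^ 2) ^ 2 := by rw [bondWeight]; ring
  rw [h, Real.sq_sqrt (Real.sqrt_nonneg _), Real.sq_sqrt (Nat.cast_nonneg _)]

omit [NeZero n] in
lemma one_le_bondWeight {k : Fin n} (h : 1 ≤ α k) : 1 ≤ bondWeight α k := by
  have : (1 : ℝ) ≤ α k := by exact_mod_cast h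
  exact Real.one_le_sqrt.2 (Real.one_le_sqrt.2 this)

lemma mpsLearningRate_eq (k : Fin n) :
    mpsLearningRate α k = ((bondWeight α k * bondWeight α (k + 1)) ^ 2)⁻¹ := by
  rw [mpsLearningRate, Real.sqrt_mul (Nat.cast_nonneg _), mul_pow, bondWeight, bondWeight,
    Real.sq_sqrt (Real.sqrt_nonneg _), Real.sq_sqrt (Real.sqrt_nonneg _)]

/-! ### Speed bounds along the gradient flow. -/

variable {m : ℕ} {X : Type*}

/-- The features of a data point. -/
def dataFeature (φ : ∀ i, X → Fin (d i) → ℝ) (x : Fin n → X) (i : Fin n) : Fin (d i) → ℝ :=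
  φ i (x i)

/-- The velocity of the tensors `A` under the gradient flow, for the training direction `D`. -/
noncomputable def flowVelocity (φ : ∀ i, X → Fin (d i) → ℝ) (x : Fin m → Fin n → X)
    (A : MPSIndex d α → ℝ) (D : Fin m → ℝ) (e : MPSIndex d α) : ℝ :=
  -(mpsLearningRate α e.1 * ∑ j, φ e.1 (x j e.1) e.2.1 *
    arcProd (siteMatrix (dataFeature φ (x j)) A) (n - 1) (e.1 + 1)
      ⟨e.1 + 1, e.2.2.2⟩ ⟨e.1, e.2.2.1⟩ * D j)

lemma IsMPSGradientFlow.hasDerivWithinAt {φ : ∀ i, X → Fin (d i) → ℝ} {x : Fin m → Fin n → X}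
    {L : (Fin m → ℝ) → ℝ} {T : ℝ} {A : ℝ → MPSIndex d α → ℝ} (h : IsMPSGradientFlow φ x L T A)
    {t : ℝ} (ht : t ∈ Set.Icc 0 T) (e : MPSIndex d α) :
    HasDerivWithinAt (fun r => A r e)
      (flowVelocity φ x (A t) (trainingDirection φ x L (A t)) e) (Set.Icc 0 T) t := by
  refine (h.hasDeriv t ht e).congr_deriv ?_
  simp only [fderiv_mpsOutput_single]
  rfl

/-- After contraction with features, the physical index enters only through inner products of
features. The transpose appears because the complementary arc runs from the right bond of the site
back to its left bond. -/
lemma siteMatrix_flowVelocity (φ : ∀ i, X → Fin (d i) → ℝ) (x : Fin m → Fin n → X)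
    (f : ∀ i, Fin (d i) → ℝ) (A : MPSIndex d α → ℝ) (D : Fin m → ℝ) (k : Fin n) :
    siteMatrix f (flowVelocity φ x A D) k = -(mpsLearningRate α k • ∑ j,
      ((∑ s, f k s * φ k (x j k) s) * D j) •
        (arcProd (siteMatrix (dataFeature φ (x j)) A) (n - 1) (k + 1))ᵀ) := by
  have hN := isBlockSupported_siteMatrix f (flowVelocity φ x A D) k
  have hW := fun j => isBlockSupported_siteMatrix (dataFeature φ (x j)) A
  ext p q
  simp only [Matrix.neg_apply, Matrix.smul_apply, Matrix.sum_apply, transpose_apply, smul_eq_mul]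
  by_cases hp : p.1 = k
  · by_cases hq : q.1 = k + 1
    · obtain ⟨k, a⟩ := p
      obtain ⟨_, b⟩ := q
      subst hp hq
      rw [siteMatrix_apply]
      simp only [flowVelocity, mul_neg, Finset.sum_neg_distrib, neg_inj, Finset.mul_sum,
        Finset.sum_mul]
      rw [Finset.sum_comm]
      exact Finset.sum_congr rfl fun j _ => Finset.sum_congr rfl fun s _ => by ring
    · rw [hN.2 p q hq]
      simp [fun j => (hW j).arcProd_apply_eq_zero_left (r := n - 1) (k := k + 1) p hq]
  · rw [hN.1 p q hp]
    have : p.1 ≠ siteShift (n - 1) (k + 1) := by rwa [siteShift_pred_succ]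
    simp [fun j => (hW j).arcProd_apply_eq_zero_right (r := n - 1) (k := k + 1) q this]

lemma hasDerivWithinAt_siteMatrix (f : ∀ i, Fin (d i) → ℝ) {A : ℝ → MPSIndex d α → ℝ}
    {A' : MPSIndex d α → ℝ} {s : Set ℝ} {t : ℝ}
    (h : ∀ e, HasDerivWithinAt (fun r => A r e) (A' e) s t) (k : Fin n) :
    HasDerivWithinAt (fun r => siteMatrix f (A r) k) (siteMatrix f A' k) s t := by
  unfold siteMatrix
  exact HasDerivWithinAt.fun_sum fun _ _ => HasDerivWithinAt.fun_sum fun _ _ =>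
    HasDerivWithinAt.fun_sum fun _ _ => ((h _).const_mul _).smul_const _

/-- The arc products of length less than `n` are at most `M` times their natural size. -/
def ArcsBounded (φ : ∀ i, X → Fin (d i) → ℝ) (x : Fin m → Fin n → X) (M : ℝ)
    (A : MPSIndex d α → ℝ) : Prop :=
  ∀ j k, ∀ r < n, ‖arcProd (siteMatrix (dataFeature φ (x j)) A) r k‖ ≤
    M * (bondWeight α k * bondWeight α (siteShift r k))

lemma ArcsBounded.norm_pred_le {φ : ∀ i, X → Fin (d i) → ℝ} {x : Fin m → Fin n → X} {M : ℝ}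
    {A : MPSIndex d α → ℝ} (h : ArcsBounded φ x M A) (j : Fin m) (k : Fin n) :
    ‖arcProd (siteMatrix (dataFeature φ (x j)) A) (n - 1) (k + 1)‖ ≤
      M * (bondWeight α k * bondWeight α (k + 1)) := by
  have := h j (k + 1) (n - 1) (Nat.sub_lt (NeZero.pos n) one_pos)
  rwa [siteShift_pred_succ, mul_comm (bondWeight α (k + 1))] at this

/-- The learning rate `(w w')⁻²` meets a complementary arc of norm at most `M w w'`, which leaves
`(w w')⁻¹`. -/
lemma norm_siteMatrix_flowVelocity_le {φ : ∀ i, X → Fin (d i) → ℝ} {x : Fin m → Fin n → X}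
    {K M : ℝ} (hα : ∀ k, 1 ≤ α k)
    (hK : ∀ j j' k, |∑ s, φ k (x j k) s * φ k (x j' k) s| ≤ K)
    {A : MPSIndex d α → ℝ} (h : ArcsBounded φ x M A) (D : Fin m → ℝ) (j : Fin m) (k : Fin n) :
    ‖siteMatrix (dataFeature φ (x j)) (flowVelocity φ x A D) k‖ ≤
      K * M * (∑ j, |D j|) / (bondWeight α k * bondWeight α (k + 1)) := by
  have hw : 0 < bondWeight α k * bondWeight α (k + 1) :=
    mul_pos (one_pos.trans_le (one_le_bondWeight (hα _)))
      (one_pos.trans_le (one_le_bondWeight (hα _)))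
  rw [siteMatrix_flowVelocity, norm_neg, norm_smul, mpsLearningRate_eq]
  set w := bondWeight α k * bondWeight α (k + 1)
  have hK0 : 0 ≤ K := (abs_nonneg _).trans (hK j j k)
  have hsum : ‖∑ j', ((∑ s, dataFeature φ (x j) k s * φ k (x j' k) s) * D j') •
      (arcProd (siteMatrix (dataFeature φ (x j')) A) (n - 1) (k + 1))ᵀ‖ ≤
      ∑ j', K * |D j'| * (M * w) := by
    refine norm_sum_le_of_le _ fun j' _ => ?_
    rw [norm_smul, norm_mul, Real.norm_eq_abs, Real.norm_eq_abs,
      ← conjTranspose_eq_transpose_of_trivial, l2_opNorm_conjTranspose]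
    exact mul_le_mul (mul_le_mul_of_nonneg_right (hK j j' k) (abs_nonneg _))
      (h.norm_pred_le j' k) (norm_nonneg _) (by positivity)
  rw [Real.norm_of_nonneg (by positivity)]
  refine (mul_le_mul_of_nonneg_left hsum (by positivity)).trans (le_of_eq ?_)
  rw [← Finset.sum_mul, ← Finset.mul_sum]
  field_simp

/-- The weights telescope: `w_k w_i · (w_i w_{i+1})⁻¹ · w_{i+1} w_r = w_k w_r`. Two subarcs and one
velocity contribute a factor `M` each, hence `M ^ 3`. -/
lemma norm_deriv_arcProd_le {φ : ∀ i, X → Fin (d i) → ℝ} {x : Fin m → Fin n → X}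
    {K M : ℝ} (hα : ∀ k, 1 ≤ α k) (hM : 0 ≤ M)
    (hK : ∀ j j' k, |∑ s, φ k (x j k) s * φ k (x j' k) s| ≤ K)
    {A : MPSIndex d α → ℝ} (h : ArcsBounded φ x M A) (D : Fin m → ℝ) (j : Fin m) (k : Fin n)
    {r : ℕ} (hr : r < n) :
    ‖∑ i ∈ Finset.range r, arcProd (siteMatrix (dataFeature φ (x j)) A) i k *
        siteMatrix (dataFeature φ (x j)) (flowVelocity φ x A D) (siteShift i k) *
        arcProd (siteMatrix (dataFeature φ (x j)) A) (r - 1 - i) (siteShift (i + 1) k)‖ ≤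
      n * K * M ^ 3 * (bondWeight α k * bondWeight α (siteShift r k)) * ∑ j, |D j| := by
  have hK0 : 0 ≤ K := (abs_nonneg _).trans (hK j j k)
  have hD0 : 0 ≤ ∑ j, |D j| := Finset.sum_nonneg fun _ _ => abs_nonneg _
  have hw : ∀ k, 0 < bondWeight α k := fun k => one_pos.trans_le (one_le_bondWeight (hα k))
  have hterm : ∀ i ∈ Finset.range r, ‖arcProd (siteMatrix (dataFeature φ (x j)) A) i k *
        siteMatrix (dataFeature φ (x j)) (flowVelocity φ x A D) (siteShift i k) *
        arcProd (siteMatrix (dataFeature φ (x j)) A) (r - 1 - i) (siteShift (i + 1) k)‖ ≤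
      K * M ^ 3 * (bondWeight α k * bondWeight α (siteShift r k)) * ∑ j, |D j| := by
    intro i hi
    have hir := Finset.mem_range.1 hi
    have h1 := h j k i (by omega)
    have h2 := norm_siteMatrix_flowVelocity_le hα hK h D j (siteShift i k)
    have h3 := h j (siteShift (i + 1) k) (r - 1 - i) (by omega)
    rw [← siteShift_add, show i + 1 + (r - 1 - i) = r by omega] at h3
    rw [← siteShift_succ] at h2
    have w1 := hw k
    have w2 := hw (siteShift i k)
    have w3 := hw (siteShift (i + 1) k)
    have w4 := hw (siteShift r k)
    refine (norm_mul_le _ _).trans ((mul_le_mul_of_nonneg_right (norm_mul_le _ _)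
      (norm_nonneg _)).trans ?_)
    refine (mul_le_mul (mul_le_mul h1 h2 (norm_nonneg _) (by positivity)) h3 (norm_nonneg _)
      (by positivity)).trans (le_of_eq ?_)
    field_simp
  refine (norm_sum_le_of_le _ hterm).trans ?_
  rw [Finset.sum_const, Finset.card_range, nsmul_eq_mul]
  have hrn : (r : ℝ) ≤ n := by exact_mod_cast hr.le
  have w1 := hw k
  have w4 := hw (siteShift r k)
  calc (r : ℝ) * (K * M ^ 3 * (bondWeight α k * bondWeight α (siteShift r k)) * ∑ j, |D j|)
      ≤ n * (K * M ^ 3 * (bondWeight α k * bondWeight α (siteShift r k)) * ∑ j, |D j|) := by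
        gcongr
    _ = _ := by ring

lemma abs_flowVelocity_le {φ : ∀ i, X → Fin (d i) → ℝ} {x : Fin m → Fin n → X}
    {K M : ℝ} (hα : ∀ k, 1 ≤ α k) (hM : 0 ≤ M) (hK0 : 0 ≤ K)
    (hK : ∀ j k s, |φ k (x j k) s| ≤ K)
    {A : MPSIndex d α → ℝ} (h : ArcsBounded φ x M A) (D : Fin m → ℝ) (e : MPSIndex d α) :
    ‖flowVelocity φ x A D e‖ ≤ K * M * ∑ j, |D j| := by
  have hw1 : 1 ≤ bondWeight α e.1 * bondWeight α (e.1 + 1) :=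
    one_le_mul_of_one_le_of_one_le (one_le_bondWeight (hα _)) (one_le_bondWeight (hα _))
  rw [flowVelocity, norm_neg, norm_mul, mpsLearningRate_eq]
  have hp := fun j => h.norm_pred_le j e.1
  set w := bondWeight α e.1 * bondWeight α (e.1 + 1)
  have hw : 0 < w := one_pos.trans_le hw1
  rw [Real.norm_of_nonneg (by positivity)]
  have hsum : ‖∑ j, φ e.1 (x j e.1) e.2.1 *
      arcProd (siteMatrix (dataFeature φ (x j)) A) (n - 1) (e.1 + 1)
        ⟨e.1 + 1, e.2.2.2⟩ ⟨e.1, e.2.2.1⟩ * D j‖ ≤ ∑ j, K * (M * w) * |D j| := by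
    refine norm_sum_le_of_le _ fun j _ => ?_
    rw [norm_mul, norm_mul, Real.norm_eq_abs, Real.norm_eq_abs, Real.norm_eq_abs]
    refine mul_le_mul_of_nonneg_right ?_ (abs_nonneg _)
    exact mul_le_mul (hK j _ _) ((abs_apply_le_l2_opNorm _ _ _).trans (hp j)) (abs_nonneg _) hK0
  refine (mul_le_mul_of_nonneg_left hsum (by positivity)).trans ?_
  rw [← Finset.mul_sum]
  have hD0 : 0 ≤ ∑ j, |D j| := Finset.sum_nonneg fun _ _ => abs_nonneg _
  calc (w ^ 2)⁻¹ * (K * (M * w) * ∑ j, |D j|) = (K * M * ∑ j, |D j|) * w⁻¹ := by field_simp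
    _ ≤ (K * M * ∑ j, |D j|) * 1 := by gcongr; exact inv_le_one_of_one_le₀ hw1
    _ = _ := mul_one _

namespace IsMPSGradientFlow

variable {φ : ∀ i, X → Fin (d i) → ℝ} {x : Fin m → Fin n → X}
  {L : (Fin m → ℝ) → ℝ} {T : ℝ} {A : ℝ → MPSIndex d α → ℝ} (h : IsMPSGradientFlow φ x L T A)
include h

lemma continuousOn : ContinuousOn A (Set.Icc 0 T) :=
  continuousOn_pi.2 fun e => fun t ht => (h.hasDeriv t ht e).continuousWithinAt

lemma aemeasurable_trainingDirection (j : Fin m) :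
    AEMeasurable (fun t => trainingDirection φ x L (A t) j) (volume.restrict (Set.Icc 0 T)) := by
  have hc : Continuous (mpsOutputs (α := α) φ x) :=
    continuous_pi fun j => (differentiable_mpsOutput φ (x j)).continuous
  exact (measurable_fderiv_apply_const ℝ L (Pi.single j 1)).comp_aemeasurable
    ((hc.comp_continuousOn h.continuousOn).aemeasurable measurableSet_Icc)

lemma integrableOn_and_integral_le {C : ℝ≥0}
    (hC : ∀ j, ∫⁻ t in Set.Icc 0 T, ‖trainingDirection φ x L (A t) j‖ₑ ≤ C) :
    IntegrableOn (fun t => ∑ j, |trainingDirection φ x L (A t) j|) (Set.Icc 0 T) ∧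
      ∫ t in Set.Icc 0 T, ∑ j, |trainingDirection φ x L (A t) j| ≤ m * C := by
  have hi : ∀ j, IntegrableOn (fun t => trainingDirection φ x L (A t) j) (Set.Icc 0 T) := fun j =>
    ⟨(h.aemeasurable_trainingDirection j).aestronglyMeasurable,
      (hC j).trans_lt ENNReal.coe_lt_top⟩
  refine ⟨integrable_finsetSum _ fun j _ => (hi j).norm, ?_⟩
  simp only [← Real.norm_eq_abs]
  rw [integral_finsetSum _ fun j _ => (hi j).norm]
  refine (Finset.sum_le_card_nsmul _ _ (C : ℝ) fun j _ => ?_).trans (by simp)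
  rw [integral_norm_eq_lintegral_enorm (hi j).aestronglyMeasurable]
  exact ENNReal.toReal_le_coe_of_le_coe (hC j)

/-- If the arc products are small compared with their natural size at time `0`, then they remain
so. -/
lemma arcsBounded (hα : ∀ k, 1 ≤ α k) {K δ : ℝ} {C : ℝ≥0} (hδ : 0 < δ)
    (hK : ∀ j j' k, |∑ s, φ k (x j k) s * φ k (x j' k) s| ≤ K)
    (hC : ∀ j, ∫⁻ t in Set.Icc 0 T, ‖trainingDirection φ x L (A t) j‖ₑ ≤ C)
    (h0 : ArcsBounded φ x δ (A 0)) (hlt : δ + n * K * (2 * δ) ^ 3 * (m * C) < 2 * δ) :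
    ∀ t ∈ Set.Icc 0 T, ArcsBounded φ x (2 * δ) (A t) := by
  obtain ⟨hDi, hDC⟩ := h.integrableOn_and_integral_le hC
  have hw : ∀ k, 0 < bondWeight α k := fun k => one_pos.trans_le (one_le_bondWeight (hα k))
  -- Norms are divided by their natural size, so that one threshold serves all arcs in the
  -- continuity argument.
  let G : Fin m × Fin n × Fin n → ℝ → ℝ := fun i t =>
    ‖arcProd (siteMatrix (dataFeature φ (x i.1)) (A t)) i.2.2 i.2.1‖ /
      (bondWeight α i.2.1 * bondWeight α (siteShift i.2.2 i.2.1))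
  have hG : ∀ M t, (∀ i, G i t ≤ M) ↔ ArcsBounded φ x M (A t) := by
    intro M t
    constructor
    · intro hi j k r hr
      exact (div_le_iff₀ (mul_pos (hw _) (hw _))).1 (hi (j, k, ⟨r, hr⟩))
    · intro hi ⟨j, k, r⟩
      exact (div_le_iff₀ (mul_pos (hw _) (hw _))).2 (hi j k r r.2)
  have hcont : ∀ i, ContinuousOn (G i) (Set.Icc 0 T) := fun i =>
    (((continuous_arcProd_siteMatrix _ _ _).norm).comp_continuousOn h.continuousOn).div_const _
  have key := lt_of_continuity_argument (M := 2 * δ) hcont ?_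
  · exact fun t ht => (hG _ t).1 fun i => (key t ht i).le
  rintro t ht hs ⟨j, k, r⟩
  have hww : 0 < bondWeight α k * bondWeight α (siteShift r k) := mul_pos (hw _) (hw _)
  have hK0 : 0 ≤ K := (abs_nonneg _).trans (hK j j k)
  have hmove := norm_sub_le_of_speed_le ht
    (fun s hs => hasDerivWithinAt_arcProd
      (fun k => hasDerivWithinAt_siteMatrix (dataFeature φ (x j))
        (fun e => h.hasDerivWithinAt hs e) k) (isBlockSupported_siteMatrix _ _) r k)
    (fun s => Finset.sum_nonneg fun _ _ => abs_nonneg _) hDi hDC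
    (B := n * K * (2 * δ) ^ 3 * (bondWeight α k * bondWeight α (siteShift r k))) (by positivity)
    (fun s hs' => norm_deriv_arcProd_le hα (by positivity) hK ((hG _ s).1 (hs s hs')) _ j k r.2)
  have h1 := h0 j k r r.2
  have h2 := norm_le_norm_add_norm_sub' (arcProd (siteMatrix (dataFeature φ (x j)) (A t)) r k)
    (arcProd (siteMatrix (dataFeature φ (x j)) (A 0)) r k)
  rw [div_lt_iff₀ hww]
  calc _ ≤ (δ + n * K * (2 * δ) ^ 3 * (m * C)) *
        (bondWeight α k * bondWeight α (siteShift r k)) := by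
        refine (h2.trans (add_le_add h1 hmove)).trans (le_of_eq ?_)
        ring
    _ < _ := mul_lt_mul_of_pos_right hlt hww

/-- If the arc products are small compared with their natural size at time `0`, then the entries
move little. -/
lemma abs_sub_le (hα : ∀ k, 1 ≤ α k) {K δ : ℝ} {C : ℝ≥0} (hδ : 0 < δ) (hK0 : 0 ≤ K)
    (hK : ∀ j j' k, |∑ s, φ k (x j k) s * φ k (x j' k) s| ≤ K)
    (hK' : ∀ j k s, |φ k (x j k) s| ≤ K)
    (hC : ∀ j, ∫⁻ t in Set.Icc 0 T, ‖trainingDirection φ x L (A t) j‖ₑ ≤ C)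
    (h0 : ArcsBounded φ x δ (A 0)) (hlt : δ + n * K * (2 * δ) ^ 3 * (m * C) < 2 * δ)
    {t : ℝ} (ht : t ∈ Set.Icc 0 T) (e : MPSIndex d α) :
    ‖A t e - A 0 e‖ ≤ K * (2 * δ) * (m * C) := by
  obtain ⟨hDi, hDC⟩ := h.integrableOn_and_integral_le hC
  have hb := h.arcsBounded hα hδ hK hC h0 hlt
  exact norm_sub_le_of_speed_le ht (fun s hs => h.hasDerivWithinAt hs e)
    (fun s => Finset.sum_nonneg fun _ _ => abs_nonneg _) hDi hDC (by positivity)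
    (fun s hs => abs_flowVelocity_le hα (by positivity) hK0 hK'
      (hb s ⟨hs.1, hs.2.le.trans ht.2⟩) _ e)

end IsMPSGradientFlow

end Flow

/-! ### Lazy training -/

section Lazy

open Matrix
open scoped Matrix.Norms.L2Operator

variable {n m : ℕ} [NeZero n] {X : Type*} {d α : Fin n → ℕ}

lemma measurableSet_arcsBounded (φ : ∀ i, X → Fin (d i) → ℝ) (x : Fin m → Fin n → X) (M : ℝ) :
    MeasurableSet {A : MPSIndex d α → ℝ | ArcsBounded φ x M A} := by
  refine IsClosed.measurableSet ?_
  simp only [ArcsBounded, Set.ofPred_forall]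
  exact isClosed_iInter fun j => isClosed_iInter fun k => isClosed_iInter fun r =>
    isClosed_iInter fun _ => isClosed_le (continuous_arcProd_siteMatrix _ _ _).norm
      continuous_const

/-- At a Gaussian initialization, the arc products are small compared with their natural size with
high probability. -/
lemma gaussianProduct_not_arcsBounded_le (φ : ∀ i, X → Fin (d i) → ℝ) (x : Fin m → Fin n → X)
    (ν : Fin n → ℝ≥0) {V θ δ : ℝ} (hα : ∀ k, 1 ≤ α k)
    (hV : ∀ j k, (ν k * ∑ s, φ k (x j k) s ^ 2) ^ 2 * (α k * α (k + 1)) ≤ V)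
    (hθ : ∀ k, 1 ≤ θ * α k) (hδ : 0 < δ) :
    gaussianProduct (fun e : MPSIndex d α => ν e.1) {A | ¬ ArcsBounded φ x δ A} ≤
      ∑ i : Fin m × Fin n × Fin n, ENNReal.ofReal (θ * ((3 * V) ^ (i.2.2 : ℕ) / δ ^ 4)) := by
  have hα0 : ∀ k, (0 : ℝ) < α k := fun k => by exact_mod_cast hα k
  have hsub : {A : MPSIndex d α → ℝ | ¬ ArcsBounded φ x δ A} ⊆ ⋃ i : Fin m × Fin n × Fin n,
      {A | ENNReal.ofReal (δ ^ 4 * (α i.2.1 * α (siteShift i.2.2 i.2.1))) ≤ ENNReal.ofReal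
        (schattenFour (arcProd (siteMatrix (dataFeature φ (x i.1)) A) i.2.2 i.2.1))} := by
    intro A hA
    simp only [ArcsBounded, Set.mem_ofPred_eq, not_forall, not_le] at hA
    obtain ⟨j, k, r, hr, hlt⟩ := hA
    refine Set.mem_iUnion.2 ⟨(j, k, ⟨r, hr⟩), ENNReal.ofReal_le_ofReal ?_⟩
    refine le_trans ?_ (l2_opNorm_pow_four_le_schattenFour _)
    rw [← bondWeight_pow_four k, ← bondWeight_pow_four (siteShift r k), ← mul_pow, ← mul_pow]
    have hw : ∀ k, 0 ≤ bondWeight α k := fun k => Real.sqrt_nonneg _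
    exact pow_le_pow_left₀ (mul_nonneg hδ.le (mul_nonneg (hw _) (hw _))) hlt.le 4
  refine (measure_mono hsub).trans ((measure_iUnion_fintype_le _ _).trans
    (Finset.sum_le_sum fun i _ => ?_))
  obtain ⟨j, k, r⟩ := i
  have hpos : 0 < δ ^ 4 * (α k * α (siteShift r k) : ℝ) :=
    mul_pos (by positivity) (mul_pos (hα0 _) (hα0 _))
  have hm : Measurable fun A : MPSIndex d α → ℝ => ENNReal.ofReal
      (schattenFour (arcProd (siteMatrix (dataFeature φ (x j)) A) r k)) :=
    (continuous_schattenFour.comp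
      (continuous_arcProd_siteMatrix _ r k)).measurable.ennreal_ofReal
  -- Markov's inequality for the fourth power: the threshold contains the same `α k * α (siteShift r
  -- k)` as the moment bound, and only `θ (3V)^r / δ^4` remains.
  refine (meas_ge_le_lintegral_div hm.aemeasurable (ENNReal.ofReal_pos.2 hpos).ne'
    ENNReal.ofReal_ne_top).trans ?_
  refine (ENNReal.div_le_div_right
    (lintegral_arcProd_le (dataFeature φ (x j)) ν hα (hV j) hθ r.2.le k).1 _).trans ?_
  rw [← ENNReal.ofReal_div_of_pos hpos]
  refine ENNReal.ofReal_le_ofReal (le_of_eq ?_)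
  have h1 := (hα0 k).ne'
  have h2 := (hα0 (siteShift r k)).ne'
  field_simp

/-- The scaling of the variance exactly cancels the bond dimensions, so `V` can be chosen
independently of them. -/
lemma mpsVariance_mul_sq (σ : Fin n → ℝ≥0) (hα : ∀ k, 1 ≤ α k) (k : Fin n) (S : ℝ) :
    (((σ k ^ 2 / NNReal.sqrt ((α k : ℝ≥0) * (α (k + 1) : ℝ≥0)) : ℝ≥0) : ℝ) * S) ^ 2 *
      (α k * α (k + 1)) = (σ k ^ 2 * S) ^ 2 := by
  have h0 : (0 : ℝ) < α k * α (k + 1) :=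
    mul_pos (by exact_mod_cast hα k) (by exact_mod_cast hα (k + 1))
  have hs : √((α k : ℝ) * α (k + 1)) ^ 2 = α k * α (k + 1) := Real.sq_sqrt h0.le
  have hs0 : √((α k : ℝ) * α (k + 1)) ≠ 0 := (Real.sqrt_pos.2 h0).ne'
  rw [← hs]
  push_cast
  field_simp

/-- For large bond dimensions, the arc products at the initialization are small compared with
their natural size with probability close to one. -/
lemma tendsto_measure_not_arcsBounded (φ : ∀ i, X → Fin (d i) → ℝ) (x : Fin m → Fin n → X)
    (σ : Fin n → ℝ≥0) {Ω : Type*} [MeasurableSpace Ω] (P : Measure Ω) [IsProbabilityMeasure P]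
    {ι : Type*} (l : Filter ι) (α : ι → Fin n → ℕ) (hα : ∀ i, Tendsto (fun ν => α ν i) l atTop)
    (A : ∀ ν, Ω → MPSIndex d (α ν) → ℝ) (hA : ∀ ν, IsMPSGaussianInit P σ (A ν))
    {δ : ℝ} (hδ : 0 < δ) :
    Tendsto (fun ν => P {ω | ¬ ArcsBounded φ x δ (A ν ω)}) l (𝓝 0) := by
  obtain ⟨V, hV⟩ := (Set.finite_range fun i : Fin m × Fin n =>
    (σ i.2 ^ 2 * ∑ s, φ i.2 (x i.1 i.2) s ^ 2 : ℝ) ^ 2).bddAbove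
  have hV' : ∀ j k, (σ k ^ 2 * ∑ s, φ k (x j k) s ^ 2 : ℝ) ^ 2 ≤ V := fun j k =>
    hV ⟨(j, k), rfl⟩
  -- The sum of the inverse bond dimensions serves as `θ`: it dominates each `1 / α k` and tends to
  -- zero along any filter.
  have hθ : Tendsto (fun ν => ∑ i, ((α ν i : ℝ))⁻¹) l (𝓝 0) := by
    have := tendsto_finsetSum (Finset.univ : Finset (Fin n)) fun i _ =>
      tendsto_inv_atTop_zero.comp ((tendsto_natCast_atTop_atTop (R := ℝ)).comp (hα i))
    simpa using this
  have hbound : Tendsto (fun ν => ∑ i : Fin m × Fin n × Fin n,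
      ENNReal.ofReal ((∑ i, ((α ν i : ℝ))⁻¹) * ((3 * V) ^ (i.2.2 : ℕ) / δ ^ 4))) l (𝓝 0) := by
    have := tendsto_finsetSum (Finset.univ : Finset (Fin m × Fin n × Fin n)) fun i _ =>
      ENNReal.tendsto_ofReal (hθ.mul_const ((3 * V) ^ (i.2.2 : ℕ) / δ ^ 4))
    simpa using this
  have hα1 : ∀ᶠ ν in l, ∀ k, 1 ≤ α ν k :=
    eventually_all.2 fun k => (hα k).eventually_ge_atTop 1
  refine tendsto_of_tendsto_of_tendsto_of_le_of_le' tendsto_const_nhds hbound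
    (Eventually.of_forall fun _ => zero_le) ?_
  filter_upwards [hα1] with ν hν
  have hlaw := (hA ν).indep.hasLaw_pi (hA ν).hasLaw
  have heq := hlaw.measure_eq (p := fun B => ¬ ArcsBounded φ x δ B)
    (measurableSet_arcsBounded φ x δ).compl
  change P {ω | ¬ ArcsBounded φ x δ (fun e => A ν ω e)} ≤ _
  rw [heq]
  refine gaussianProduct_not_arcsBounded_le φ x
    (fun i => σ i ^ 2 / NNReal.sqrt ((α ν i : ℝ≥0) * (α ν (i + 1) : ℝ≥0))) hν
    (fun j k => ?_) (fun k => ?_) hδ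
  · rw [mpsVariance_mul_sq σ hν]
    exact hV' j k
  · have hk : (0 : ℝ) < α ν k := by exact_mod_cast hν k
    rw [← inv_mul_cancel₀ hk.ne']
    refine mul_le_mul_of_nonneg_right ?_ hk.le
    exact Finset.single_le_sum (f := fun i => ((α ν i : ℝ))⁻¹)
      (fun i _ => inv_nonneg.2 (Nat.cast_nonneg _)) (Finset.mem_univ k)

/-- Finitely many quantities bounded in probability have a common bound. -/
lemma BoundedInProbability.exists_common_bound {ι Ω κ : Type*} [Fintype κ] [MeasurableSpace Ω]
    {P : Measure Ω} {l : Filter ι} {Y : κ → ι → Ω → ℝ≥0∞}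
    (h : ∀ j, BoundedInProbability P l (Y j)) {δ : ℝ≥0∞} (hδ : 0 < δ) :
    ∃ C : ℝ≥0, ∀ᶠ ν in l, P {ω | ∃ j, (C : ℝ≥0∞) < Y j ν ω} ≤ δ := by
  obtain ⟨δ', hδ', hsum⟩ := ENNReal.exists_pos_sum_of_countable' hδ.ne' κ
  choose C hC using fun j => h j (δ' j) (hδ' j)
  refine ⟨Finset.univ.sup C, ?_⟩
  filter_upwards [eventually_all.2 hC] with ν hν
  rw [Set.ofPred_exists]
  refine (measure_iUnion_fintype_le _ _).trans (le_trans (Finset.sum_le_sum fun j _ => ?_)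
    ((tsum_fintype δ').symm.le.trans hsum.le))
  refine (measure_mono fun ω hω => ?_).trans (hν j)
  exact lt_of_le_of_lt (ENNReal.coe_le_coe.2 (Finset.le_sup (Finset.mem_univ j))) hω

/-- The bootstrap error is cubic in `δ`, hence negligible against `δ` however large the bound on the
training direction. -/
lemma exists_pos_small (a b : ℝ) {r : ℝ} (hr : 0 < r) :
    ∃ δ : ℝ, 0 < δ ∧ δ + a * δ ^ 3 < 2 * δ ∧ b * δ ≤ r := by
  have h1 : Tendsto (fun δ : ℝ => a * δ ^ 2) (𝓝[>] 0) (𝓝 0) := by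
    have : Tendsto (fun δ : ℝ => a * δ ^ 2) (𝓝 0) (𝓝 (a * 0 ^ 2)) :=
      (by fun_prop : Continuous fun δ : ℝ => a * δ ^ 2).tendsto 0
    simpa using this.mono_left nhdsWithin_le_nhds
  have h2 : Tendsto (fun δ : ℝ => b * δ) (𝓝[>] 0) (𝓝 0) := by
    have : Tendsto (fun δ : ℝ => b * δ) (𝓝 0) (𝓝 (b * 0)) :=
      (by fun_prop : Continuous fun δ : ℝ => b * δ).tendsto 0
    simpa using this.mono_left nhdsWithin_le_nhds
  have h0 : ∀ᶠ δ : ℝ in 𝓝[>] 0, 0 < δ := self_mem_nhdsWithin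
  obtain ⟨δ, hδ0, hδ1, hδ2⟩ := (h0.and
    ((h1.eventually_lt_const one_pos).and (h2.eventually_le_const hr))).exists
  refine ⟨δ, hδ0, ?_, hδ2⟩
  nlinarith [mul_lt_mul_of_pos_right hδ1 hδ0]

end Lazy

theorem lemma3p5
    {n m : ℕ} [NeZero n] {X : Type*} (d : Fin n → ℕ)
    (φ : ∀ i, X → Fin (d i) → ℝ) (x : Fin m → Fin n → X) (L : (Fin m → ℝ) → ℝ)
    (σ : Fin n → ℝ≥0) (T : ℝ) (hT : 0 ≤ T)
    {Ω : Type*} [MeasurableSpace Ω] (P : Measure Ω) [IsProbabilityMeasure P]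
    {ι : Type*} (l : Filter ι) (α : ι → Fin n → ℕ)
    (hα : ∀ i, Tendsto (fun ν => α ν i) l atTop)
    (A : ∀ ν, Ω → ℝ → MPSIndex d (α ν) → ℝ)
    (hinit : ∀ ν, IsMPSGaussianInit P σ (fun ω => A ν ω 0))
    (hflow : ∀ ν, ∀ᵐ ω ∂P, IsMPSGradientFlow φ x L T (A ν ω))
    (hdir : ∀ j, BoundedInProbability P l
      (fun ν ω => ∫⁻ t in Set.Icc 0 T, ‖trainingDirection φ x L (A ν ω t) j‖ₑ)) :
    ∀ ε : ℝ≥0∞, 0 < ε → Tendsto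
      (fun ν => P {ω | ε ≤ ⨆ e, ⨆ t ∈ Set.Icc 0 T, ‖A ν ω t e - A ν ω 0 e‖ₑ}) l (𝓝 0) := by
  intro ε hε
  rw [ENNReal.tendsto_nhds_zero]
  intro η hη
  -- A threshold strictly below `ε` is taken, since the event to be excluded is `ε ≤ sup`; it also
  -- covers `ε = ∞`.
  obtain ⟨r, hr0, hrε⟩ := ENNReal.lt_iff_exists_nnreal_btwn.1 hε
  obtain ⟨C, hC⟩ := BoundedInProbability.exists_common_bound hdir (ENNReal.half_pos hη.ne')
  obtain ⟨K₁, hK₁⟩ := (Set.finite_range fun i : Fin m × Fin m × Fin n =>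
    |∑ s, φ i.2.2 (x i.1 i.2.2) s * φ i.2.2 (x i.2.1 i.2.2) s|).bddAbove
  obtain ⟨K₂, hK₂⟩ := (Set.finite_range fun i : Fin m × (Σ k : Fin n, Fin (d k)) =>
    |φ i.2.1 (x i.1 i.2.1) i.2.2|).bddAbove
  -- The `0` is needed when there are no data points, as `K₁` and `K₂` then have no sign.
  set K := max 0 (max K₁ K₂)
  have hK0 : 0 ≤ K := le_max_left _ _
  have hK : ∀ j j' k, |∑ s, φ k (x j k) s * φ k (x j' k) s| ≤ K := fun j j' k =>
    (hK₁ ⟨(j, j', k), rfl⟩).trans ((le_max_left _ _).trans (le_max_right _ _))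
  have hK' : ∀ j k s, |φ k (x j k) s| ≤ K := fun j k s =>
    (hK₂ ⟨(j, ⟨k, s⟩), rfl⟩).trans ((le_max_right _ _).trans (le_max_right _ _))
  obtain ⟨δ, hδ0, hδ1, hδ2⟩ := exists_pos_small (n * K * 2 ^ 3 * (m * C)) (K * 2 * (m * C))
    (r := r) (by exact_mod_cast hr0)
  have hinit' := ENNReal.tendsto_nhds_zero.1
    (tendsto_measure_not_arcsBounded φ x σ P l α hα (fun ν ω => A ν ω 0) hinit hδ0) (η / 2)
    (ENNReal.half_pos hη.ne')
  have hα1 : ∀ᶠ ν in l, ∀ k, 1 ≤ α ν k :=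
    eventually_all.2 fun k => (hα k).eventually_ge_atTop 1
  filter_upwards [hC, hinit', hα1] with ν hCν hinitν hαν
  -- Only monotonicity and subadditivity of `P` are used from here on, so the events need not be
  -- measurable.
  have hle : P {ω | ε ≤ ⨆ e, ⨆ t ∈ Set.Icc 0 T, ‖A ν ω t e - A ν ω 0 e‖ₑ} ≤
      P ({ω | ∃ j, (C : ℝ≥0∞) < ∫⁻ t in Set.Icc 0 T, ‖trainingDirection φ x L (A ν ω t) j‖ₑ} ∪
        {ω | ¬ ArcsBounded φ x δ (A ν ω 0)}) := by
    refine measure_mono_ae ?_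
    filter_upwards [hflow ν] with ω hω hsup
    by_contra hgood
    change ¬ (_ ∨ _) at hgood
    simp only [Set.mem_ofPred_eq, not_or, not_exists, not_lt, not_not] at hgood
    refine absurd (hsup.trans (iSup_le fun e => iSup₂_le fun t ht => ?_)) (not_le.2 hrε)
    have := hω.abs_sub_le hαν hδ0 hK0 hK hK' hgood.1 hgood.2
      (lt_of_eq_of_lt (by ring) hδ1) ht e
    rw [enorm_le_coe]
    exact_mod_cast this.trans (le_of_eq_of_le (by ring) hδ2)
  calc _ ≤ _ := hle
    _ ≤ _ := measure_union_le _ _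
    _ ≤ η / 2 + η / 2 := add_le_add hCν hinitν
    _ = η := ENNReal.add_halves η
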